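/- Let $N,m\ge 1$ be integers, let $M=\mathbb{T}^N=\mathbb{R}^N/\mathbb{Z}^N$ be the flat torus, with all tangent and cotangent spaces identified with $\mathbb{R}^N$ (Euclidean norm $|\cdot|$), and let $\|\cdot\|$ be the maximum norm on $\mathbb{R}^m$. For $1\le i\le m$ let $H_i:M\times\mathbb{R}^N\times\mathbb{R}^m\to\mathbb{R}$, $(x,p,\mathbf{u})\mapsto H_i(x,p,\mathbf{u})$, satisfy: (H1) $H_i$ is of class $C^2$ in $(x,p,\mathbf{u})$; (H2) $p\mapsto H_i(x,p,\mathbf{u})$ is strictly convex for every $(x,\mathbf{u})$; (H3) $H_i(x,p,\mathbf{u})/|p|\to\infty$ as $|p|\to\infty$, for every $(x,\mathbf{u})$; (H4) there is $\Theta_i>0$ such that $|H_i(x,p,\mathbf{u})-H_i(x,p,\mathbf{v})|\le\Theta_i\|\mathbf{u}-\mathbf{v}\|$ for all $x,p,\mathbf{u},\mathbf{v}$. Let $L_i(x,v,\mathbf{u})=\sup_{p\in\mathbb{R}^N}\{\langle p,v\rangle-H_i(x,p,\mathbf{u})\}$ be the convex dual of $H_i$, and let $\varphi\in C(M,\mathbb{R}^m)$.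 Consider the Cauchy problem $$\partial_t u_i+H_i(x,\partial_x u_i,\mathbf{u})=0\ \text{ on } M\times[0,\infty),\qquad \mathbf{u}(\cdot,0)=\varphi,\qquad 1\le i\le m. \tag{1}$$ A continuous function $\mathbf{u}:M\times[0,\infty)\to\mathbb{R}^m$ is a viscosity subsolution (resp. supersolution) of (1) if for each $i$ one has $u_i(\cdot,0)\le\varphi_i$ (resp. $\ge$) on $M$ and, whenever $\psi$ is a real-valued $C^1$ function near a point $(x,t)$ with $t>0$ such that $u_i-\psi$ has a local maximum (resp. minimum) at $(x,t)$, $$\partial_t\psi(x,t)+H_i(x,\partial_x\psi(x,t),\mathbf{u}(x,t))\le 0\quad(\text{resp. }\ge 0).$$ It is a viscosity solution if it is both. Then (1) has a unique viscosity solution $\mathbf{u}\in C(M\times[0,\infty),\mathbb{R}^m)$. Moreover, a function $\mathbf{u}\in C(M\times[0,\infty),\mathbb{R}^m)$ is a viscosity solution of (1) if and only if, for all $1\le i\le m$ and all $(x,t)\in M\times[0,\infty)$, $$u_i(x,t)=\inf_{\gamma}\Big\{\varphi_i(\gamma(0))+\int_0^t L_i(\gamma(s),\dot\gamma(s),\mathbf{u}(\gamma(s),s))\,ds\Big\},$$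 where the infimum is over all absolutely continuous curves $\gamma:[0,t]\to M$ with $\gamma(t)=x$ (the integral being possibly $+\infty$). In particular, the unique viscosity solution is given by this implicit formula. -/

import Mathlib

open scoped NNReal

noncomputable section

namespace WeaklyCoupledHJ

/-- The Euclidean space `ℝ^N`; every tangent and cotangent space of the flat torus is identified
with it. -/
abbrev E (N : ℕ) : Type := EuclideanSpace ℝ (Fin N)

/-- The flat torus `M = 𝕋^N = ℝ^N / ℤ^N`. -/
abbrev Torus (N : ℕ) : Type := UnitAddTorus (Fin N)

/-- The quotient map `ℝ^N → 𝕋^N`. -/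
def proj {N : ℕ} (x : E N) : Torus N := fun j => ((x j : ℝ) : UnitAddCircle)

/-- The standing conditions on a single Hamiltonian `H(x, p, u)` on `T*M × ℝ^m`. The space `ℝ^m` is
`Fin m → ℝ`, which carries the maximum norm. Regularity on the torus is regularity of the lift
to `ℝ^N`. -/
structure IsAdmissible {N m : ℕ} (H : Torus N → E N → (Fin m → ℝ) → ℝ) : Prop where
  /-- `H` is of class `C²` in `(x, p, u)`. -/
  contDiff : ContDiff ℝ 2 (fun q : E N × E N × (Fin m → ℝ) => H (proj q.1) q.2.1 q.2.2)
  /-- `H` is strictly convex in `p`. -/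
  strictConvex : ∀ x u, StrictConvexOn ℝ Set.univ (fun p => H x p u)
  /-- `H` is superlinear in `p`. -/
  superlinear : ∀ x u,
    Filter.Tendsto (fun p => H x p u / ‖p‖) (Bornology.cobounded (E N)) Filter.atTop
  /-- `H` is Lipschitz in `u`, uniformly in `(x, p)`. -/
  lipschitz : ∃ Θ : ℝ, 0 < Θ ∧ ∀ x p u v, |H x p u - H x p v| ≤ Θ * ‖u - v‖

/-- The convex dual `L(x, v, u) = sup_p (⟨p, v⟩ - H(x, p, u))`; the supremum is that of a set which
is bounded above whenever `H` is continuous and superlinear in `p`. -/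
def lagrangian {N m : ℕ} (H : Torus N → E N → (Fin m → ℝ) → ℝ)
    (x : Torus N) (v : E N) (u : Fin m → ℝ) : ℝ :=
  ⨆ p : E N, (inner ℝ p v - H x p u)

/-- Viscosity subsolutions of `∂ₜ uᵢ + Hᵢ(x, ∂ₓ uᵢ, u) = 0` on `𝕋^N × [0, ∞)` with initial datum `φ`.
Since `proj` is a local diffeomorphism, a `C¹` test function near a point `(proj x, t)` of
`𝕋^N × (0, ∞)` is the same as a `C¹` function `ψ` near `(x, t)`. -/
def IsViscositySubsolution {N m : ℕ} (H : Fin m → Torus N → E N → (Fin m → ℝ) → ℝ)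
    (φ : C(Torus N, Fin m → ℝ)) (u : C(Torus N × ℝ≥0, Fin m → ℝ)) : Prop :=
  ∀ i : Fin m,
    (∀ x, u (x, 0) i ≤ φ x i) ∧
    ∀ (x : E N) (t : ℝ), 0 < t → ∀ ψ : E N × ℝ → ℝ, ContDiffAt ℝ 1 ψ (x, t) →
      IsLocalMax (fun q : E N × ℝ => u (proj q.1, q.2.toNNReal) i - ψ q) (x, t) →
      deriv (fun s => ψ (x, s)) t
        + H i (proj x) (gradient (fun y => ψ (y, t)) x) (u (proj x, t.toNNReal)) ≤ 0

/-- Viscosity supersolutions of the same Cauchy problem. -/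
def IsViscositySupersolution {N m : ℕ} (H : Fin m → Torus N → E N → (Fin m → ℝ) → ℝ)
    (φ : C(Torus N, Fin m → ℝ)) (u : C(Torus N × ℝ≥0, Fin m → ℝ)) : Prop :=
  ∀ i : Fin m,
    (∀ x, φ x i ≤ u (x, 0) i) ∧
    ∀ (x : E N) (t : ℝ), 0 < t → ∀ ψ : E N × ℝ → ℝ, ContDiffAt ℝ 1 ψ (x, t) →
      IsLocalMin (fun q : E N × ℝ => u (proj q.1, q.2.toNNReal) i - ψ q) (x, t) →
      0 ≤ deriv (fun s => ψ (x, s)) t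
        + H i (proj x) (gradient (fun y => ψ (y, t)) x) (u (proj x, t.toNNReal))

/-- Viscosity solutions: both sub- and supersolutions. -/
def IsViscositySolution {N m : ℕ} (H : Fin m → Torus N → E N → (Fin m → ℝ) → ℝ)
    (φ : C(Torus N, Fin m → ℝ)) (u : C(Torus N × ℝ≥0, Fin m → ℝ)) : Prop :=
  IsViscositySubsolution H φ u ∧ IsViscositySupersolution H φ u

/-- The integrand `s ↦ L(γ(s), γ'(s), u(γ(s), s))` along a curve on the torus given by its
lift `γ` to `ℝ^N`. -/
def lagrangianAlong {N m : ℕ} (H : Torus N → E N → (Fin m → ℝ) → ℝ)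
    (u : C(Torus N × ℝ≥0, Fin m → ℝ)) (γ : ℝ → E N) (s : ℝ) : ℝ :=
  lagrangian H (proj (γ s)) (deriv γ s) (u (proj (γ s), s.toNNReal))

/-- The values `φᵢ(γ(0)) + ∫₀ᵗ Lᵢ(γ, γ', u(γ(s), s)) ds` over the absolutely continuous curves `γ`
on the torus with `γ(t) = x`. The absolutely continuous curves on `𝕋^N` are the projections of those
in `ℝ^N`, with the same velocity. The integrand is bounded below along each of them, so its integral
is finite or `+∞`; the curves of infinite action, for which the Bochner integral would take the
value `0`, do not contribute to the infimum and are left out. -/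
def actionValues {N m : ℕ} (H : Fin m → Torus N → E N → (Fin m → ℝ) → ℝ)
    (φ : C(Torus N, Fin m → ℝ)) (u : C(Torus N × ℝ≥0, Fin m → ℝ))
    (i : Fin m) (x : Torus N) (t : ℝ≥0) : Set ℝ :=
  {a | ∃ γ : ℝ → E N, AbsolutelyContinuousOnInterval γ 0 t ∧ proj (γ t) = x ∧
    IntervalIntegrable (lagrangianAlong (H i) u γ) MeasureTheory.volume 0 t ∧
    a = φ (proj (γ 0)) i + ∫ s in (0 : ℝ)..t, lagrangianAlong (H i) u γ s}

/-- Variational solutions, i.e. `u` satisfies the implicit Lax-Oleinik formula. As a greatest lower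
bound in `ℝ`, the infimum is over a nonempty set that is bounded below. -/
def IsVariationalSolution {N m : ℕ} (H : Fin m → Torus N → E N → (Fin m → ℝ) → ℝ)
    (φ : C(Torus N, Fin m → ℝ)) (u : C(Torus N × ℝ≥0, Fin m → ℝ)) : Prop :=
  ∀ (i : Fin m) (x : Torus N) (t : ℝ≥0), IsGLB (actionValues H φ u i x t) (u (x, t) i)

end WeaklyCoupledHJ

end

/-!
With a given function `w` in place of `u` inside the Lagrangian, the Lax-Oleinik formula is the
value function of a Tonelli problem. As a function of `w` it is a contraction for the supremum norm
weighted by a decaying exponential in time, and its fixed point is a variational solution. Dynamic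
programming turns a variational solution into a viscosity solution: straight segments give the
subsolution inequality, almost optimal curves the supersolution inequality.

The doubling of variables needs no condition on the dependence of `H` on `x` if one of the two
functions compared is Lipschitz in space, for then the penalized momenta stay bounded. The
variational solution is Lipschitz in space when the datum is Lipschitz. Any viscosity solution is
therefore close to the variational solution of a nearby Lipschitz datum, by a Gronwall argument for
the weak coupling, and uniqueness follows. Hence all viscosity solutions are variational.
-/

noncomputable section

open Bornology Filter MeasureTheory Set Topology

namespace WeaklyCoupledHJ

/-! ### Approximation by Lipschitz functions -/

section Approximation

variable {X : Type*} [PseudoMetricSpace X] {f : X → ℝ} {G : ℝ}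

lemma exists_sub_le_add_mul_dist (hf : UniformContinuous f) (hG : ∀ x, |f x| ≤ G)
    {κ : ℝ} (hκ : 0 < κ) : ∃ K : ℝ≥0, ∀ x y, f x - f y ≤ κ + K * dist x y := by
  obtain ⟨δ, hδ, hfδ⟩ := Metric.uniformContinuous_iff.1 hf κ hκ
  refine ⟨(2 * G / δ).toNNReal, fun x y => ?_⟩
  rcases lt_or_ge (dist x y) δ with hxy | hxy
  · calc f x - f y ≤ dist (f x) (f y) := le_abs_self _
      _ ≤ κ := (hfδ hxy).le
      _ ≤ _ := le_add_of_nonneg_right (by positivity)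
  · calc f x - f y ≤ 2 * G := by linarith [abs_le.1 (hG x), abs_le.1 (hG y)]
      _ = 2 * G / δ * δ := by field_simp
      _ ≤ (2 * G / δ).toNNReal * dist x y := by gcongr; exact Real.le_coe_toNNReal _
      _ ≤ _ := le_add_of_nonneg_left hκ.le

lemma exists_lipschitzWith_abs_sub_le (hf : UniformContinuous f) (hG : ∀ x, |f x| ≤ G)
    {ε : ℝ} (hε : 0 < ε) : ∃ (K : ℝ≥0) (g : X → ℝ), LipschitzWith K g ∧ ∀ x, |g x - f x| ≤ ε := by
  obtain ⟨K, hK⟩ := exists_sub_le_add_mul_dist hf hG hε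
  have hbdd : ∀ x, BddBelow (range fun y => f y + K * dist x y) := fun x =>
    ⟨f x - ε, forall_mem_range.2 fun y => by linarith [hK x y]⟩
  refine ⟨K, fun x => ⨅ y, (f y + K * dist x y), .of_le_add_mul K fun x y => ?_, fun x => ?_⟩
  · have : Nonempty X := ⟨x⟩
    refine sub_le_iff_le_add.1 (le_ciInf fun z => ?_)
    calc (⨅ z, (f z + K * dist x z)) - K * dist x y
        ≤ f z + K * dist x z - K * dist x y := by gcongr; exact ciInf_le (hbdd x) z
      _ ≤ f z + K * (dist x y + dist y z) - K * dist x y := by gcongr; exact dist_triangle _ _ _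
      _ = f z + K * dist y z := by ring
  · have : Nonempty X := ⟨x⟩
    have hlow : f x - ε ≤ ⨅ y, (f y + K * dist x y) := le_ciInf fun y => by linarith [hK x y]
    have hup : (⨅ y, (f y + K * dist x y)) ≤ f x := by simpa using ciInf_le (hbdd x) x
    exact abs_le.2 ⟨by linarith, by linarith⟩

lemma exists_lipschitzWith_dist_le {X ι : Type*} [PseudoMetricSpace X] [CompactSpace X]
    [Fintype ι] (f : C(X, ι → ℝ)) {ε : ℝ} (hε : 0 < ε) :
    ∃ (K : ℝ≥0) (g : C(X, ι → ℝ)), LipschitzWith K g ∧ dist g f ≤ ε := by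
  have huc : UniformContinuous f := CompactSpace.uniformContinuous_of_continuous f.continuous
  choose K g hg hgf using fun i => exists_lipschitzWith_abs_sub_le
    (uniformContinuous_pi.1 huc i) (fun x => (norm_le_pi_norm (f x) i).trans (f.norm_coe_le_norm x))
    hε
  have hlip : LipschitzWith (∑ i, K i) fun x i => g i x := .of_dist_le_mul fun x y => by
    refine (dist_pi_le_iff (by positivity)).2 fun i => ((hg i).dist_le_mul x y).trans ?_
    gcongr
    exact Finset.single_le_sum (fun _ _ => zero_le) (Finset.mem_univ i)
  exact ⟨_, ⟨_, hlip.continuous⟩, hlip,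
    (ContinuousMap.dist_le hε.le).2 fun x => (dist_pi_le_iff hε.le).2 fun i => hgf i x⟩

end Approximation

/-! ### The torus and its universal cover -/

lemma proj_add {N : ℕ} (x y : E N) : proj (x + y) = proj x + proj y := by
  funext j; simp [proj]

lemma proj_sub {N : ℕ} (x y : E N) : proj (x - y) = proj x - proj y := by
  funext j; simp [proj]

lemma isOpenQuotientMap_proj (N : ℕ) : IsOpenQuotientMap (proj : E N → Torus N) := by
  have hpi : IsOpenQuotientMap (Pi.map fun _ : Fin N => ((↑) : ℝ → UnitAddCircle)) :=
    IsOpenQuotientMap.piMap fun _ => QuotientAddGroup.isOpenQuotientMap_mk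
  exact hpi.comp (EuclideanSpace.equiv (Fin N) ℝ).toHomeomorph.isOpenQuotientMap

lemma proj_surjective (N : ℕ) : Function.Surjective (proj : E N → Torus N) :=
  (isOpenQuotientMap_proj N).surjective

lemma lipschitzWith_proj (N : ℕ) : LipschitzWith 1 (proj : E N → Torus N) :=
  .of_dist_le_mul fun x y => by
    rw [NNReal.coe_one, one_mul, dist_eq_norm x y]
    refine (dist_pi_le_iff (norm_nonneg _)).2 fun j => ?_
    calc dist (proj x j) (proj y j) ≤ ‖x j - y j‖ := by
          rw [dist_eq_norm]
          exact QuotientAddGroup.norm_mk_le_norm (S := AddSubgroup.zmultiples (1 : ℝ))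
            (m := x j - y j)
      _ ≤ ‖x - y‖ := PiLp.norm_apply_le (x - y) j

lemma continuous_proj (N : ℕ) : Continuous (proj : E N → Torus N) :=
  (lipschitzWith_proj N).continuous

lemma exists_proj_eq_norm_le (N : ℕ) : ∃ R : ℝ, ∀ x : Torus N, ∃ y : E N, proj y = x ∧ ‖y‖ ≤ R := by
  have hcompact : IsCompact (WithLp.toLp 2 '' univ.pi fun _ : Fin N => Icc (0 : ℝ) 1) :=
    (isCompact_univ_pi fun _ => isCompact_Icc).image (PiLp.continuous_toLp 2 _)
  obtain ⟨R, hR⟩ := hcompact.isBounded.exists_norm_le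
  refine ⟨R, fun x => ?_⟩
  have hcoord (j : Fin N) : ∃ r ∈ Icc (0 : ℝ) (0 + 1), (r : UnitAddCircle) = x j := by
    simpa [← AddCircle.coe_image_Icc_eq (1 : ℝ) 0] using mem_univ (x j)
  choose r hr hrx using hcoord
  exact ⟨WithLp.toLp 2 r, funext hrx, hR _ ⟨r, fun j _ => by simpa using hr j, rfl⟩⟩

/-! ### Absolutely continuous curves -/

section AbsolutelyContinuous

variable {X Y : Type*} [PseudoMetricSpace X] [PseudoMetricSpace Y] {a b : ℝ}

lemma absolutelyContinuousOnInterval_comp_of_monotone {f : ℝ → X} {g : ℝ → ℝ} {c d : ℝ}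
    (hf : AbsolutelyContinuousOnInterval f a b) (hg : Monotone g) (hg1 : LipschitzWith 1 g)
    (hmaps : MapsTo g (uIcc c d) (uIcc a b)) :
    AbsolutelyContinuousOnInterval (f ∘ g) c d := by
  rw [absolutelyContinuousOnInterval_iff] at hf ⊢
  intro ε hε
  obtain ⟨δ, hδ, hfδ⟩ := hf ε hε
  refine ⟨δ, hδ, fun ⟨n, I⟩ hI hlen => hfδ (n, fun i => (g (I i).1, g (I i).2)) ⟨?_, ?_⟩ ?_⟩
  · exact fun i hi => ⟨hmaps (hI.1 i hi).1, hmaps (hI.1 i hi).2⟩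
  · intro i hi j hj hij
    have hdisj := hI.2 hi hj hij
    simp only [Function.onFun, uIoc, Ioc_disjoint_Ioc, ← hg.map_min, ← hg.map_max] at hdisj ⊢
    exact hg hdisj
  · exact (Finset.sum_le_sum fun i _ => by simpa using hg1.dist_le_mul _ _).trans_lt hlen

lemma absolutelyContinuousOnInterval_of_dist_le {f : ℝ → X} {g : ℝ → Y} {K : ℝ}
    (hf : AbsolutelyContinuousOnInterval f a b)
    (hg : ∀ s ∈ uIcc a b, ∀ t ∈ uIcc a b, dist (g s) (g t) ≤ K * (dist (f s) (f t) + dist s t)) :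
    AbsolutelyContinuousOnInterval g a b := by
  have hid : AbsolutelyContinuousOnInterval (fun s : ℝ => s) a b :=
    (LipschitzWith.id.lipschitzOnWith (s := uIcc a b)).absolutelyContinuousOnInterval
  unfold AbsolutelyContinuousOnInterval at hf hid ⊢
  refine squeeze_zero' (.of_forall fun _ => Finset.sum_nonneg fun _ _ => dist_nonneg) ?_
    (by simpa using (hf.add hid).const_mul K)
  rw [eventually_inf_principal]
  filter_upwards with I hI
  rw [← Finset.sum_add_distrib, Finset.mul_sum]
  exact Finset.sum_le_sum fun i hi => hg _ (hI.1 i hi).1 _ (hI.1 i hi).2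

lemma absolutelyContinuousOnInterval_lipschitzWith_comp {f : ℝ → X} {g : X → Y} {K : ℝ≥0}
    (hg : LipschitzWith K g) (hf : AbsolutelyContinuousOnInterval f a b) :
    AbsolutelyContinuousOnInterval (g ∘ f) a b :=
  absolutelyContinuousOnInterval_of_dist_le hf fun s _ t _ =>
    (hg.dist_le_mul _ _).trans (by gcongr; exact le_add_of_nonneg_right dist_nonneg)

lemma sub_le_integral_of_deriv_le {f g : ℝ → ℝ} (hab : a ≤ b)
    (hf : AbsolutelyContinuousOnInterval f a b) (hg : IntervalIntegrable g volume a b)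
    (hfg : ∀ᵐ s, s ∈ Ioo a b → deriv f s ≤ g s) : f b - f a ≤ ∫ s in a..b, g s := by
  rw [← hf.integral_deriv_eq_sub]
  refine intervalIntegral.integral_mono_ae_restrict hab hf.intervalIntegrable_deriv hg ?_
  rw [← restrict_Ioo_eq_restrict_Icc]
  exact (ae_restrict_iff' measurableSet_Ioo).2 hfg

variable {V : Type*} [NormedAddCommGroup V] [NormedSpace ℝ V] [FiniteDimensional ℝ V]

lemma ae_hasDerivAt_of_absolutelyContinuousOnInterval {γ : ℝ → V}
    (hγ : AbsolutelyContinuousOnInterval γ a b) :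
    ∀ᵐ s, s ∈ Ioo a b → HasDerivAt γ (deriv γ s) s := by
  filter_upwards [hγ.boundedVariationOn.ae_differentiableAt_of_mem_uIcc] with s hs hsab
  exact (hs (Icc_subset_uIcc ⟨hsab.1.le, hsab.2.le⟩)).hasDerivAt

lemma norm_sub_le_integral_of_norm_deriv_le {γ : ℝ → V} {g : ℝ → ℝ} (hab : a ≤ b)
    (hγ : AbsolutelyContinuousOnInterval γ a b) (hg : IntervalIntegrable g volume a b)
    (hγg : ∀ s ∈ Ioo a b, ‖deriv γ s‖ ≤ g s) : ‖γ b - γ a‖ ≤ ∫ s in a..b, g s := by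
  obtain ⟨l, hl, hlγ⟩ := exists_dual_vector'' ℝ (γ b - γ a)
  have hac : AbsolutelyContinuousOnInterval (l ∘ γ) a b :=
    absolutelyContinuousOnInterval_lipschitzWith_comp l.lipschitz hγ
  calc ‖γ b - γ a‖ = l (γ b) - l (γ a) := by rw [← map_sub, hlγ, RCLike.ofReal_real_eq_id, id]
    _ ≤ ∫ s in a..b, g s := sub_le_integral_of_deriv_le hab hac hg ?_
  filter_upwards [ae_hasDerivAt_of_absolutelyContinuousOnInterval hγ] with s hs hsab
  calc deriv (l ∘ γ) s = l (deriv γ s) := (l.hasFDerivAt.comp_hasDerivAt s (hs hsab)).deriv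
    _ ≤ ‖l‖ * ‖deriv γ s‖ := (le_abs_self _).trans (l.le_opNorm _)
    _ ≤ 1 * ‖deriv γ s‖ := by gcongr
    _ ≤ g s := by simpa using hγg s hsab

end AbsolutelyContinuous

section Concatenation

variable {V : Type*} [NormedAddCommGroup V] {γ σ : ℝ → V} {a b c : ℝ}

/-- The curve equal to `γ` before time `b` and to `σ` after it, provided `γ b = σ b`. Writing it
with `min` and `max` makes its absolute continuity evident. -/
def concat (γ σ : ℝ → V) (b : ℝ) (s : ℝ) : V :=
  γ (min s b) + (σ (max s b) - σ b)

lemma eqOn_concat_left : EqOn (concat γ σ b) γ (Iic b) := fun s hs => by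
  simp [concat, min_eq_left (mem_Iic.1 hs), max_eq_right (mem_Iic.1 hs)]

lemma eqOn_concat_right (hb : γ b = σ b) : EqOn (concat γ σ b) σ (Ici b) := fun s hs => by
  simp [concat, min_eq_right (mem_Ici.1 hs), max_eq_left (mem_Ici.1 hs), hb]

lemma absolutelyContinuousOnInterval_concat (hab : a ≤ b) (hbc : b ≤ c)
    (hγ : AbsolutelyContinuousOnInterval γ a b) (hσ : AbsolutelyContinuousOnInterval σ b c) :
    AbsolutelyContinuousOnInterval (concat γ σ b) a c := by
  have hleft : AbsolutelyContinuousOnInterval (γ ∘ fun s => min s b) a c := by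
    refine absolutelyContinuousOnInterval_comp_of_monotone hγ (fun s t h => min_le_min_right b h)
      (LipschitzWith.id.min_const b) fun s hs => ?_
    rw [uIcc_of_le (hab.trans hbc)] at hs
    exact Icc_subset_uIcc ⟨le_min hs.1 hab, min_le_right _ _⟩
  have hright : AbsolutelyContinuousOnInterval (σ ∘ fun s => max s b) a c := by
    refine absolutelyContinuousOnInterval_comp_of_monotone hσ (fun s t h => max_le_max_right b h)
      (LipschitzWith.id.max_const b) fun s hs => ?_
    rw [uIcc_of_le (hab.trans hbc)] at hs
    exact Icc_subset_uIcc ⟨le_max_right _ _, max_le hs.2 hbc⟩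
  have hsub : AbsolutelyContinuousOnInterval (fun s => σ (max s b) - σ b) a c :=
    absolutelyContinuousOnInterval_of_dist_le (K := 1) hright fun s _ t _ => by simp
  exact hleft.add hsub

end Concatenation

/-! ### Tonelli costs and their value functions -/

section Value

variable {V : Type*} [NormedAddCommGroup V] [NormedSpace ℝ V]

/-- A Tonelli running cost `ℓ(x, v, s)`: superlinear in the velocity `v`, uniformly in the position
and locally uniformly in time. The bounds hold for all times `s ≤ T`, since the costs below are
extended to `s < 0` by their value at `0`. -/
structure IsTonelliCost (ℓ : V → V → ℝ → ℝ) : Prop where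
  continuous : Continuous fun q : V × V × ℝ => ℓ q.1 q.2.1 q.2.2
  superlinear : ∀ A T : ℝ, ∃ C, 0 ≤ C ∧ ∀ x v, ∀ s ≤ T, A * ‖v‖ - C ≤ ℓ x v s
  bounded : ∀ R T : ℝ, ∃ C, 0 ≤ C ∧ ∀ x v, ‖v‖ ≤ R → ∀ s ≤ T, ℓ x v s ≤ C
  timeModulus : ∀ (T : ℝ) {ε : ℝ}, 0 < ε → ∃ δ > 0, ∀ x v, ∀ s ≤ T, ∀ r ≤ T, |s - r| ≤ δ →
    |ℓ x v s - ℓ x v r| ≤ ε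

/-- The absolutely continuous curves on `[a, b]` along which the cost `ℓ` is integrable. -/
structure IsFiniteActionCurve (ℓ : V → V → ℝ → ℝ) (γ : ℝ → V) (a b : ℝ) : Prop where
  absolutelyContinuous : AbsolutelyContinuousOnInterval γ a b
  intervalIntegrable : IntervalIntegrable (fun s => ℓ (γ s) (deriv γ s) s) volume a b

/-- The action `∫ₐᵇ ℓ(γ, γ', s) ds`. -/
def action (ℓ : V → V → ℝ → ℝ) (γ : ℝ → V) (a b : ℝ) : ℝ :=
  ∫ s in a..b, ℓ (γ s) (deriv γ s) s

/-- The payoffs `g(γ(a)) + ∫ₐᵇ ℓ(γ, γ', s) ds` of the curves of finite action that end at `x`. -/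
def payoffs (ℓ : V → V → ℝ → ℝ) (g : V → ℝ) (a : ℝ) (x : V) (b : ℝ) : Set ℝ :=
  {r | ∃ γ : ℝ → V, IsFiniteActionCurve ℓ γ a b ∧ γ b = x ∧ r = g (γ a) + action ℓ γ a b}

/-- The value function at time `b`, for the cost `ℓ` and the datum `g` at time `a`. -/
def value (ℓ : V → V → ℝ → ℝ) (g : V → ℝ) (a : ℝ) (x : V) (b : ℝ) : ℝ :=
  sInf (payoffs ℓ g a x b)

variable {ℓ ℓ' : V → V → ℝ → ℝ} {g g' : V → ℝ} {γ : ℝ → V} {a b c C G K T : ℝ} {x : V}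

namespace IsFiniteActionCurve

lemma mono (hγ : IsFiniteActionCurve ℓ γ a b) {c d : ℝ} (h : uIcc c d ⊆ uIcc a b) :
    IsFiniteActionCurve ℓ γ c d :=
  ⟨hγ.absolutelyContinuous.mono h, hγ.intervalIntegrable.mono_set h⟩

lemma left (hγ : IsFiniteActionCurve ℓ γ a c) (hab : a ≤ b) (hbc : b ≤ c) :
    IsFiniteActionCurve ℓ γ a b :=
  hγ.mono (by rw [uIcc_of_le hab, uIcc_of_le (hab.trans hbc)]; exact Icc_subset_Icc_right hbc)

lemma right (hγ : IsFiniteActionCurve ℓ γ a c) (hab : a ≤ b) (hbc : b ≤ c) :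
    IsFiniteActionCurve ℓ γ b c :=
  hγ.mono (by rw [uIcc_of_le hbc, uIcc_of_le (hab.trans hbc)]; exact Icc_subset_Icc_left hab)

lemma action_add_action (hγ : IsFiniteActionCurve ℓ γ a c) (hab : a ≤ b) (hbc : b ≤ c) :
    action ℓ γ a b + action ℓ γ b c = action ℓ γ a c :=
  intervalIntegral.integral_add_adjacent_intervals (hγ.left hab hbc).intervalIntegrable
    (hγ.right hab hbc).intervalIntegrable

end IsFiniteActionCurve

lemma isFiniteActionCurve_affine (hℓ : Continuous fun q : V × V × ℝ => ℓ q.1 q.2.1 q.2.2)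
    (x v : V) (a b c : ℝ) : IsFiniteActionCurve ℓ (fun s => x + (s - c) • v) a b where
  absolutelyContinuous :=
    ((contDiff_const.add ((contDiff_id.sub contDiff_const).smul contDiff_const)).contDiffOn
      (n := 1)).absolutelyContinuousOnInterval
  intervalIntegrable := by
    have hderiv : deriv (fun s : ℝ => x + (s - c) • v) = fun _ => v := by
      funext s; simp [deriv_smul_const]
    have hcont : Continuous fun s : ℝ => ℓ (x + (s - c) • v) v s :=
      hℓ.comp (f := fun s : ℝ => (x + (s - c) • v, v, s)) (by fun_prop)
    simpa only [hderiv] using hcont.intervalIntegrable a b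

lemma action_affine (x v : V) (a b c : ℝ) :
    action ℓ (fun s => x + (s - c) • v) a b = ∫ s in a..b, ℓ (x + (s - c) • v) v s := by
  simp [action, deriv_smul_const]

lemma isFiniteActionCurve_const (hℓ : Continuous fun q : V × V × ℝ => ℓ q.1 q.2.1 q.2.2)
    (x : V) (a b : ℝ) : IsFiniteActionCurve ℓ (fun _ => x) a b := by
  simpa using isFiniteActionCurve_affine hℓ x 0 a b 0

lemma eqOn_integrand_of_eqOn {σ : ℝ → V} {s : Set ℝ} (hs : IsOpen s) (h : EqOn γ σ s) :
    EqOn (fun r => ℓ (γ r) (deriv γ r) r) (fun r => ℓ (σ r) (deriv σ r) r) s := fun r hr => by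
  have hγσ : γ =ᶠ[𝓝 r] σ := h.eventuallyEq_of_mem (hs.mem_nhds hr)
  simp only [hγσ.deriv_eq, hγσ.eq_of_nhds]

lemma IsFiniteActionCurve.concat (hγ : IsFiniteActionCurve ℓ γ a b)
    {σ : ℝ → V} (hσ : IsFiniteActionCurve ℓ σ b c) (hab : a ≤ b) (hbc : b ≤ c) (hb : γ b = σ b) :
    IsFiniteActionCurve ℓ (concat γ σ b) a c ∧
      action ℓ (WeaklyCoupledHJ.concat γ σ b) a c = action ℓ γ a b + action ℓ σ b c := by
  have hl := eqOn_integrand_of_eqOn (ℓ := ℓ) (s := uIoo a b) isOpen_Ioo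
    (eqOn_concat_left.mono fun s hs => (by rw [uIoo_of_le hab] at hs; exact hs.2.le) :
      EqOn (WeaklyCoupledHJ.concat γ σ b) γ _)
  have hr := eqOn_integrand_of_eqOn (ℓ := ℓ) (s := uIoo b c) isOpen_Ioo
    ((eqOn_concat_right hb).mono fun s hs => by rw [uIoo_of_le hbc] at hs; exact hs.1.le)
  have hil := hγ.intervalIntegrable.congr_uIoo hl.symm
  have hir := hσ.intervalIntegrable.congr_uIoo hr.symm
  refine ⟨⟨absolutelyContinuousOnInterval_concat hab hbc hγ.1 hσ.1, hil.trans hir⟩, ?_⟩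
  rw [action, ← intervalIntegral.integral_add_adjacent_intervals hil hir,
    intervalIntegral.integral_congr_uIoo hl, intervalIntegral.integral_congr_uIoo hr, action,
    action]

lemma IsFiniteActionCurve.comp_add_right {h : ℝ} (hγ : IsFiniteActionCurve ℓ γ (a + h) (b + h)) :
    IsFiniteActionCurve (fun x v s => ℓ x v (s + h)) (fun s => γ (s + h)) a b where
  absolutelyContinuous := absolutelyContinuousOnInterval_comp_of_monotone
    hγ.absolutelyContinuous (fun s t hst => by simpa using hst)
    (by simpa using LipschitzWith.id.add (.const h))
    (by rw [← image_add_const_uIcc]; exact mapsTo_image _ _)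
  intervalIntegrable := by
    simpa [deriv_comp_add_const] using hγ.intervalIntegrable.comp_add_right h

lemma action_comp_add_right (h : ℝ) :
    action (fun x v s => ℓ x v (s + h)) (fun s => γ (s + h)) a b = action ℓ γ (a + h) (b + h) := by
  simp only [action, deriv_comp_add_const]
  exact intervalIntegral.integral_comp_add_right (fun s => ℓ (γ s) (deriv γ s) s) h

section Perturbation

variable [FiniteDimensional ℝ V] {e : ℝ → ℝ}

lemma aestronglyMeasurable_comp_curve (hℓ : Continuous fun q : V × V × ℝ => ℓ q.1 q.2.1 q.2.2)
    (hγ : ContinuousOn γ (uIcc a b)) :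
    AEStronglyMeasurable (fun s => ℓ (γ s) (deriv γ s) s) (volume.restrict (uIoc a b)) := by
  have : CompleteSpace V := FiniteDimensional.complete ℝ V
  have hγm : AEStronglyMeasurable γ (volume.restrict (uIoc a b)) :=
    (hγ.mono uIoc_subset_uIcc).aestronglyMeasurable measurableSet_uIoc
  exact hℓ.comp_aestronglyMeasurable (hγm.prodMk
    ((stronglyMeasurable_deriv γ).aestronglyMeasurable.prodMk continuous_id.aestronglyMeasurable))

lemma IsFiniteActionCurve.of_abs_sub_le (hγ : IsFiniteActionCurve ℓ γ a b)
    (hℓ' : Continuous fun q : V × V × ℝ => ℓ' q.1 q.2.1 q.2.2) (hab : a ≤ b) (he : Continuous e)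
    (hℓe : ∀ x v, ∀ s ∈ Icc a b, |ℓ' x v s - ℓ x v s| ≤ e s) :
    IsFiniteActionCurve ℓ' γ a b ∧ action ℓ' γ a b ≤ action ℓ γ a b + ∫ s in a..b, e s := by
  have hei : IntervalIntegrable e volume a b := he.intervalIntegrable a b
  have hℓ'i : IntervalIntegrable (fun s => ℓ' (γ s) (deriv γ s) s) volume a b := by
    refine (hγ.intervalIntegrable.norm.add hei).mono_fun'
      (aestronglyMeasurable_comp_curve hℓ' hγ.absolutelyContinuous.continuousOn) ?_
    refine (ae_restrict_iff' measurableSet_uIoc).2 (.of_forall fun s hs => ?_)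
    rw [uIoc_of_le hab] at hs
    have habs := abs_sub_abs_le_abs_sub (ℓ' (γ s) (deriv γ s) s) (ℓ (γ s) (deriv γ s) s)
    simp only [Real.norm_eq_abs]
    linarith [hℓe (γ s) (deriv γ s) s ⟨hs.1.le, hs.2⟩]
  refine ⟨⟨hγ.absolutelyContinuous, hℓ'i⟩, ?_⟩
  rw [action, action, ← intervalIntegral.integral_add hγ.intervalIntegrable hei]
  exact intervalIntegral.integral_mono_on hab hℓ'i (hγ.intervalIntegrable.add hei) fun s hs => by
    linarith [abs_le.1 (hℓe (γ s) (deriv γ s) s hs)]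

end Perturbation

lemma mul_sub_le_action (hγ : IsFiniteActionCurve ℓ γ a b) (hab : a ≤ b)
    (hC : ∀ x v, ∀ s ≤ b, -C ≤ ℓ x v s) : -C * (b - a) ≤ action ℓ γ a b := by
  calc -C * (b - a) = ∫ _ in a..b, -C := by simp [mul_comm]
    _ ≤ action ℓ γ a b := intervalIntegral.integral_mono_on hab intervalIntegrable_const
        hγ.intervalIntegrable fun s hs => hC _ _ s hs.2

lemma mul_norm_sub_le_action [FiniteDimensional ℝ V] (hγ : IsFiniteActionCurve ℓ γ a b)
    (hab : a ≤ b) (hK : 0 ≤ K) (hC : ∀ x v, ∀ s ≤ b, K * ‖v‖ - C ≤ ℓ x v s) :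
    K * ‖γ b - γ a‖ ≤ action ℓ γ a b + C * (b - a) := by
  have hi : IntervalIntegrable (fun s => ℓ (γ s) (deriv γ s) s + C) volume a b :=
    hγ.intervalIntegrable.add intervalIntegrable_const
  have h_int : ∫ s in a..b, (ℓ (γ s) (deriv γ s) s + C) = action ℓ γ a b + C * (b - a) := by
    rw [intervalIntegral.integral_add hγ.intervalIntegrable intervalIntegrable_const, action]
    simp [mul_comm]
  rcases hK.eq_or_lt with rfl | hK
  · linarith [mul_sub_le_action hγ hab (C := C) fun x v s hs => by simpa using hC x v s hs]
  · rw [← h_int, mul_comm, ← le_div_iff₀ hK, ← intervalIntegral.integral_div]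
    refine norm_sub_le_integral_of_norm_deriv_le hab hγ.absolutelyContinuous (hi.div_const K)
      fun s hs => ?_
    rw [le_div_iff₀ hK]
    linarith [hC (γ s) (deriv γ s) s hs.2.le]

namespace IsTonelliCost

lemma le_value (hℓ : IsTonelliCost ℓ) {r : ℝ}
    (hr : ∀ γ, IsFiniteActionCurve ℓ γ a b → γ b = x → r ≤ g (γ a) + action ℓ γ a b) :
    r ≤ value ℓ g a x b :=
  le_csInf ⟨_, fun _ => x, isFiniteActionCurve_const hℓ.continuous x a b, rfl, rfl⟩
    fun _ ⟨γ, hγ, hx, h⟩ => h ▸ hr γ hγ hx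

lemma isGLB_value (hℓ : IsTonelliCost ℓ) (hG : ∀ x, |g x| ≤ G) (x : V) (hab : a ≤ b) :
    IsGLB (payoffs ℓ g a x b) (value ℓ g a x b) := by
  refine isGLB_csInf ⟨_, fun _ => x, isFiniteActionCurve_const hℓ.continuous x a b, rfl, rfl⟩ ?_
  obtain ⟨C, -, hC⟩ := hℓ.superlinear 0 b
  refine ⟨-G + -C * (b - a), ?_⟩
  rintro _ ⟨γ, hγ, -, rfl⟩
  exact add_le_add (abs_le.1 (hG _)).1
    (mul_sub_le_action hγ hab fun x v s hs => by simpa using hC x v s hs)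

lemma value_le (hℓ : IsTonelliCost ℓ) (hG : ∀ x, |g x| ≤ G) (hab : a ≤ b)
    (hγ : IsFiniteActionCurve ℓ γ a b) :
    value ℓ g a (γ b) b ≤ g (γ a) + action ℓ γ a b :=
  (hℓ.isGLB_value hG (γ b) hab).1 ⟨γ, hγ, rfl, rfl⟩

lemma exists_lt_value_add (hℓ : IsTonelliCost ℓ) (hG : ∀ x, |g x| ≤ G) (x : V) (hab : a ≤ b)
    {ε : ℝ} (hε : 0 < ε) :
    ∃ γ, IsFiniteActionCurve ℓ γ a b ∧ γ b = x ∧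
      g (γ a) + action ℓ γ a b < value ℓ g a x b + ε := by
  obtain ⟨_, ⟨γ, hγ, hx, rfl⟩, -, hlt⟩ :=
    (hℓ.isGLB_value hG x hab).exists_between (lt_add_of_pos_right _ hε)
  exact ⟨γ, hγ, hx, hlt⟩

lemma value_self (hℓ : IsTonelliCost ℓ) (hG : ∀ x, |g x| ≤ G) (a : ℝ) (x : V) :
    value ℓ g a x a = g x := by
  refine le_antisymm ?_ (hℓ.le_value fun γ _ hx => by simp [action, hx])
  simpa [action] using hℓ.value_le hG le_rfl (isFiniteActionCurve_const hℓ.continuous x a a)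

lemma abs_value_le (hℓ : IsTonelliCost ℓ) (hG : ∀ x, |g x| ≤ G) (x : V) (hab : a ≤ b)
    (hlow : ∀ x v, ∀ s ≤ b, -C ≤ ℓ x v s) (hup : ∀ x, ∀ s ≤ b, ℓ x 0 s ≤ C) :
    |value ℓ g a x b| ≤ G + C * (b - a) := by
  refine abs_le.2 ⟨hℓ.le_value fun γ hγ _ => ?_, ?_⟩
  · linarith [(abs_le.1 (hG (γ a))).1, mul_sub_le_action hγ hab hlow]
  · have hconst := isFiniteActionCurve_const hℓ.continuous x a b
    have haction : action ℓ (fun _ => x) a b ≤ C * (b - a) := by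
      calc action ℓ (fun _ => x) a b ≤ ∫ _ in a..b, C :=
            intervalIntegral.integral_mono_on hab hconst.intervalIntegrable
              intervalIntegrable_const fun s hs => by simpa using hup x s hs.2
        _ = C * (b - a) := by simp [mul_comm]
    linarith [hℓ.value_le hG hab hconst, (abs_le.1 (hG x)).2]

lemma exists_abs_value_le (hℓ : IsTonelliCost ℓ) (hG : ∀ x, |g x| ≤ G) (a b : ℝ) :
    ∃ B, ∀ x, ∀ s ∈ Icc a b, |value ℓ g a x s| ≤ B := by
  obtain ⟨C₁, hC₁, hlow⟩ := hℓ.superlinear 0 b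
  obtain ⟨C₂, hC₂, hup⟩ := hℓ.bounded 0 b
  refine ⟨G + (C₁ + C₂) * (b - a), fun x s hs => (hℓ.abs_value_le hG x hs.1 (C := C₁ + C₂)
    (fun y v r hr => ?_) fun y r hr => ?_).trans ?_⟩
  · linarith [hlow y v r (hr.trans hs.2)]
  · linarith [hup y 0 (by simp) r (hr.trans hs.2)]
  · have := hs.2
    gcongr

lemma value_value (hℓ : IsTonelliCost ℓ) (hG : ∀ x, |g x| ≤ G) (x : V) (hab : a ≤ b)
    (hbc : b ≤ c) :
    value ℓ (fun y => value ℓ g a y b) b x c = value ℓ g a x c := by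
  obtain ⟨B, hB⟩ := hℓ.exists_abs_value_le hG a b
  have hB' (y : V) : |value ℓ g a y b| ≤ B := hB y b ⟨hab, le_rfl⟩
  refine le_antisymm (hℓ.le_value ?_) (hℓ.le_value ?_)
  · rintro γ hγ rfl
    have hinit := hℓ.value_le hG hab (hγ.left hab hbc)
    have hlast := hℓ.value_le hB' hbc (hγ.right hab hbc)
    linarith [hγ.action_add_action hab hbc]
  · rintro σ hσ rfl
    refine le_of_forall_pos_le_add fun ε hε => ?_
    obtain ⟨γ, hγ, hb, hlt⟩ := hℓ.exists_lt_value_add hG (σ b) hab hε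
    obtain ⟨hγσ, haction⟩ := hγ.concat hσ hab hbc hb
    have hle := hℓ.value_le hG (hab.trans hbc) hγσ
    rw [eqOn_concat_left (mem_Iic.2 hab), eqOn_concat_right hb (mem_Ici.2 hbc), haction] at hle
    linarith

lemma value_le_value_add_action (hℓ : IsTonelliCost ℓ) (hG : ∀ x, |g x| ≤ G) (hab : a ≤ b)
    (hbc : b ≤ c) (hγ : IsFiniteActionCurve ℓ γ b c) :
    value ℓ g a (γ c) c ≤ value ℓ g a (γ b) b + action ℓ γ b c := by
  obtain ⟨B, hB⟩ := hℓ.exists_abs_value_le hG a b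
  rw [← hℓ.value_value hG (γ c) hab hbc]
  exact hℓ.value_le (fun y => hB y b ⟨hab, le_rfl⟩) hbc hγ

lemma value_add_smul_le (hℓ : IsTonelliCost ℓ) (hG : ∀ x, |g x| ≤ G) (x v : V) (hab : a ≤ b)
    (hbc : b ≤ c) :
    value ℓ g a (x + (c - b) • v) c ≤
      value ℓ g a x b + ∫ s in b..c, ℓ (x + (s - b) • v) v s := by
  have hle := hℓ.value_le_value_add_action hG hab hbc
    (isFiniteActionCurve_affine hℓ.continuous x v b c b)
  rwa [action_affine, sub_self, zero_smul, add_zero] at hle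

lemma value_le_value_add_mul (hℓ : IsTonelliCost ℓ) (hG : ∀ x, |g x| ≤ G)
    (hC : ∀ x v, ‖v‖ ≤ 1 → ∀ s ≤ T, ℓ x v s ≤ C) {x y : V} (hab : a ≤ b) (hbc : b ≤ c)
    (hcT : c ≤ T) (hxy : ‖y - x‖ ≤ c - b) :
    value ℓ g a y c ≤ value ℓ g a x b + C * (c - b) := by
  obtain ⟨v, hv, hy⟩ : ∃ v : V, ‖v‖ ≤ 1 ∧ x + (c - b) • v = y := by
    refine ⟨(c - b)⁻¹ • (y - x), ?_, ?_⟩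
    · rw [norm_smul, norm_inv, Real.norm_of_nonneg (sub_nonneg.2 hbc)]
      exact inv_mul_le_one_of_le₀ hxy (sub_nonneg.2 hbc)
    · rcases hbc.eq_or_lt with rfl | hbc
      · have : y = x := by simpa [sub_eq_zero] using hxy
        simp [this]
      · rw [smul_inv_smul₀ (sub_pos.2 hbc).ne', add_sub_cancel]
  have hcont : Continuous fun s : ℝ => ℓ (x + (s - b) • v) v s :=
    hℓ.continuous.comp (f := fun s : ℝ => (x + (s - b) • v, v, s)) (by fun_prop)
  calc value ℓ g a y c ≤ value ℓ g a x b + ∫ s in b..c, ℓ (x + (s - b) • v) v s :=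
        hy ▸ hℓ.value_add_smul_le hG x v hab hbc
    _ ≤ value ℓ g a x b + ∫ _ in b..c, C := by
        gcongr
        exact intervalIntegral.integral_mono_on hbc (hcont.intervalIntegrable b c)
          intervalIntegrable_const fun s hs => hC _ _ hv _ (hs.2.trans hcT)
    _ = value ℓ g a x b + C * (c - b) := by simp [mul_comm]

variable [FiniteDimensional ℝ V]

lemma value_le_value_shift (hℓ : IsTonelliCost ℓ) (hℓ' : IsTonelliCost ℓ')
    (hG : ∀ x, |g' x| ≤ G) {κ h : ℝ} {e : ℝ → ℝ} (x : V) (hab : a ≤ b) (hg : ∀ x, g' x ≤ g x + κ)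
    (he : Continuous e) (hℓe : ∀ x v, ∀ s ∈ Icc a b, |ℓ' x v s - ℓ x v (s + h)| ≤ e s) :
    value ℓ' g' a x b ≤ value ℓ g (a + h) x (b + h) + (κ + ∫ s in a..b, e s) := by
  refine sub_le_iff_le_add.1 (hℓ.le_value ?_)
  rintro γ hγ rfl
  obtain ⟨hγ', haction⟩ := hγ.comp_add_right.of_abs_sub_le hℓ'.continuous hab he hℓe
  rw [action_comp_add_right] at haction
  linarith [hℓ'.value_le hG hab hγ', hg (γ (a + h))]

lemma value_le_value_add_integral (hℓ : IsTonelliCost ℓ) (hℓ' : IsTonelliCost ℓ')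
    (hG : ∀ x, |g x| ≤ G) {e : ℝ → ℝ} (x : V) (hab : a ≤ b) (he : Continuous e)
    (hℓe : ∀ x v, ∀ s ∈ Icc a b, |ℓ' x v s - ℓ x v s| ≤ e s) :
    value ℓ' g a x b ≤ value ℓ g a x b + ∫ s in a..b, e s := by
  simpa using hℓ.value_le_value_shift hℓ' hG (h := 0) (κ := 0) x hab (by simp) he
    (by simpa only [add_zero] using hℓe)

lemma datum_le_value_add (hℓ : IsTonelliCost ℓ) {κ : ℝ} (x : V) (hab : a ≤ b) (hK : 0 ≤ K)
    (hg : ∀ x y, g x - g y ≤ κ + K * dist x y)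
    (hC : ∀ x v, ∀ s ≤ b, K * ‖v‖ - C ≤ ℓ x v s) :
    g x ≤ value ℓ g a x b + (κ + C * (b - a)) := by
  refine sub_le_iff_le_add.1 (hℓ.le_value ?_)
  rintro γ hγ rfl
  have hmove := mul_norm_sub_le_action hγ hab hK hC
  rw [← dist_eq_norm] at hmove
  linarith [hg (γ b) (γ a)]

lemma value_le_value_add_time (hℓ : IsTonelliCost ℓ) (hG : ∀ x, |g x| ≤ G) {κ h : ℝ}
    {e : ℝ → ℝ} (x : V) (hab : a ≤ b) (hh : 0 ≤ h) (hK : 0 ≤ K)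
    (hg : ∀ x y, g x - g y ≤ κ + K * dist x y)
    (hC : ∀ x v, ∀ s ≤ a + h, K * ‖v‖ - C ≤ ℓ x v s)
    (he : Continuous e) (hℓe : ∀ x v, ∀ s ∈ Icc a b, |ℓ x v s - ℓ x v (s + h)| ≤ e s) :
    value ℓ g a x b ≤ value ℓ g a x (b + h) + (κ + C * h + ∫ s in a..b, e s) := by
  have hah : a ≤ a + h := le_add_of_nonneg_right hh
  have hdatum (y : V) : g y ≤ value ℓ g a y (a + h) + (κ + C * h) := by
    simpa using hℓ.datum_le_value_add y hah hK hg hC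
  simpa only [hℓ.value_value hG x hah (add_le_add_left hab h)] using
    hℓ.value_le_value_shift hℓ hG x hab hdatum he hℓe

lemma exists_abs_value_sub_le_of_le (hℓ : IsTonelliCost ℓ) (hG : ∀ x, |g x| ≤ G)
    (hg : UniformContinuous g) (a T : ℝ) {ε : ℝ} (hε : 0 < ε) :
    ∃ δ > 0, ∀ x, ∀ s t, a ≤ s → s ≤ t → t ≤ T → t - s ≤ δ →
      |value ℓ g a x s - value ℓ g a x t| ≤ ε := by
  obtain ⟨C, hC, hup⟩ := hℓ.bounded 1 T
  obtain ⟨K, hK⟩ := exists_sub_le_add_mul_dist hg hG (κ := ε / 3) (by positivity)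
  obtain ⟨D, hD, hlow⟩ := hℓ.superlinear K T
  obtain ⟨δ, hδ, hmod⟩ := hℓ.timeModulus T (ε := ε / (3 * (|T - a| + 1))) (by positivity)
  refine ⟨min δ (ε / (3 * (C + D + 1))), by positivity, fun x s t hs hst ht hδst => ?_⟩
  have hCD : (C + D) * (t - s) ≤ ε / 3 := by
    have hlen : t - s ≤ ε / (3 * (C + D + 1)) := hδst.trans (min_le_right _ _)
    rw [le_div_iff₀ (by positivity)] at hlen
    nlinarith
  have hintegral : (s - a) * (ε / (3 * (|T - a| + 1))) ≤ ε / 3 := by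
    have hsT : s - a ≤ |T - a| + 1 := by linarith [le_abs_self (T - a)]
    calc (s - a) * (ε / (3 * (|T - a| + 1))) ≤ (|T - a| + 1) * (ε / (3 * (|T - a| + 1))) := by
          gcongr
      _ = ε / 3 := by field_simp
  have hforward := hℓ.value_le_value_add_mul hG hup (x := x) (y := x) hs hst ht (by simpa using hst)
  have hbackward := hℓ.value_le_value_add_time hG (h := t - s) (κ := ε / 3) (C := D)
    (e := fun _ => ε / (3 * (|T - a| + 1))) x hs (sub_nonneg.2 hst) K.2 hK
    (fun x v r hr => hlow x v r (by linarith)) continuous_const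
    fun x v r hr => hmod x v r (by linarith [hr.2]) _ (by linarith [hr.2]) (by
      rw [sub_add_cancel_left, abs_neg, abs_of_nonneg (sub_nonneg.2 hst)]
      exact hδst.trans (min_le_left _ _))
  rw [add_sub_cancel, intervalIntegral.integral_const, smul_eq_mul] at hbackward
  have hC' : 0 ≤ C * (t - s) := mul_nonneg hC (sub_nonneg.2 hst)
  have hD' : 0 ≤ D * (t - s) := mul_nonneg hD (sub_nonneg.2 hst)
  exact abs_le.2 ⟨by linarith, by linarith⟩

lemma exists_abs_value_sub_le_of_time (hℓ : IsTonelliCost ℓ) (hG : ∀ x, |g x| ≤ G)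
    (hg : UniformContinuous g) (a T : ℝ) {ε : ℝ} (hε : 0 < ε) :
    ∃ δ > 0, ∀ x, ∀ s ∈ Icc a T, ∀ t ∈ Icc a T, |s - t| ≤ δ →
      |value ℓ g a x s - value ℓ g a x t| ≤ ε := by
  obtain ⟨δ, hδ, hle⟩ := hℓ.exists_abs_value_sub_le_of_le hG hg a T hε
  refine ⟨δ, hδ, fun x s hs t ht hst => ?_⟩
  rcases le_total s t with h | h
  · exact hle x s t hs.1 h ht.2 ((le_abs_self _).trans (abs_sub_comm s t ▸ hst))
  · rw [abs_sub_comm]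
    exact hle x t s ht.1 h hs.2 ((le_abs_self _).trans hst)

lemma exists_value_le_add_of_norm_lt (hℓ : IsTonelliCost ℓ) (hG : ∀ x, |g x| ≤ G)
    (hg : UniformContinuous g) (hab : a ≤ b) {ε : ℝ} (hε : 0 < ε) :
    ∃ δ > 0, ∀ x y, ‖y - x‖ < δ → value ℓ g a y b ≤ value ℓ g a x b + ε := by
  rcases hab.eq_or_lt with rfl | hab
  · obtain ⟨δ, hδ, hgδ⟩ := Metric.uniformContinuous_iff.1 hg ε hε
    refine ⟨δ, hδ, fun x y hxy => ?_⟩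
    rw [hℓ.value_self hG, hℓ.value_self hG]
    have hdist := hgδ (by rwa [dist_eq_norm])
    rw [Real.dist_eq] at hdist
    linarith [le_abs_self (g y - g x)]
  · obtain ⟨C, hC, hup⟩ := hℓ.bounded 1 b
    obtain ⟨δ, hδ, htime⟩ := hℓ.exists_abs_value_sub_le_of_time hG hg a b (half_pos hε)
    refine ⟨min (min δ (b - a)) (ε / (2 * (C + 1))),
      lt_min (lt_min hδ (sub_pos.2 hab)) (by positivity), fun x y hxy => ?_⟩
    obtain ⟨hδab, hyC⟩ := lt_min_iff.1 hxy
    obtain ⟨hyδ, hyab⟩ := lt_min_iff.1 hδab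
    rw [lt_div_iff₀ (by positivity)] at hyC
    have hy0 := norm_nonneg (y - x)
    have hmove := hℓ.value_le_value_add_mul hG hup (x := x) (y := y) (a := a)
      (b := b - ‖y - x‖) (by linarith) (by linarith) le_rfl (by simp)
    have hwait := htime x (b - ‖y - x‖) ⟨by linarith, by linarith⟩ b ⟨hab.le, le_rfl⟩
      (by simpa using hyδ.le)
    rw [sub_sub_cancel] at hmove
    nlinarith [(abs_le.1 hwait).2]

lemma continuous_value (hℓ : IsTonelliCost ℓ) (hG : ∀ x, |g x| ≤ G)
    (hg : UniformContinuous g) : Continuous fun q : V × ℝ≥0 => value ℓ g 0 q.1 q.2 := by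
  rw [Metric.continuous_iff]
  rintro ⟨x, t⟩ ε hε
  obtain ⟨δ, hδ, htime⟩ := hℓ.exists_abs_value_sub_le_of_time hG hg 0 (t + 1) (ε := ε / 3)
    (by positivity)
  obtain ⟨δ', hδ', hspace⟩ := hℓ.exists_value_le_add_of_norm_lt hG hg t.2 (ε := ε / 3)
    (by positivity)
  refine ⟨min δ' (min δ 1), by positivity, ?_⟩
  rintro ⟨y, s⟩ hys
  have hy : ‖y - x‖ < δ' :=
    dist_eq_norm y x ▸ (le_max_left _ _).trans_lt (hys.trans_le (min_le_left _ _))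
  obtain ⟨hs, hs1⟩ : |(s : ℝ) - t| < δ ∧ |(s : ℝ) - t| < 1 :=
    lt_min_iff.1 ((le_max_right _ _).trans_lt (hys.trans_le (min_le_right _ _)))
  have hyx := hspace x y hy
  have hxy := hspace y x (by rwa [norm_sub_rev])
  have hst := abs_le.1 (htime y s ⟨s.2, by linarith [le_abs_self ((s : ℝ) - t)]⟩ t
    ⟨t.2, by linarith⟩ hs.le)
  rw [Real.dist_eq, abs_lt]
  simp only [NNReal.val_eq_coe] at hyx hxy
  constructor <;> linarith

end IsTonelliCost

end Value

/-! ### Convex Hamiltonians and their duals -/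

/-- The convex Hamiltonians to which the Lax-Oleinik representation applies: `H` is jointly
continuous, convex and superlinear in `p`, and Lipschitz in `u` uniformly in `(x, p)`. -/
structure IsConvexHamiltonian {N m : ℕ} (H : Torus N → E N → (Fin m → ℝ) → ℝ) : Prop where
  continuous : Continuous fun q : Torus N × E N × (Fin m → ℝ) => H q.1 q.2.1 q.2.2
  convexOn : ∀ x u, ConvexOn ℝ univ fun p => H x p u
  superlinear : ∀ x u, Tendsto (fun p => H x p u / ‖p‖) (cobounded (E N)) atTop
  lipschitz : ∃ Θ : ℝ≥0, ∀ x p, LipschitzWith Θ (H x p)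

lemma IsAdmissible.isConvexHamiltonian {N m : ℕ} {H : Torus N → E N → (Fin m → ℝ) → ℝ}
    (hH : IsAdmissible H) : IsConvexHamiltonian H where
  continuous := ((isOpenQuotientMap_proj N).prodMap IsOpenQuotientMap.id).continuous_comp_iff.1
    hH.contDiff.continuous
  convexOn x u := (hH.strictConvex x u).convexOn
  superlinear := hH.superlinear
  lipschitz := by
    obtain ⟨Θ, hΘ0, hΘ⟩ := hH.lipschitz
    exact ⟨⟨Θ, hΘ0.le⟩, fun x p => LipschitzWith.of_dist_le_mul fun u v => by
      rw [Real.dist_eq, dist_eq_norm]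
      exact hΘ x p u v⟩

lemma inner_le_mul_norm {V : Type*} [NormedAddCommGroup V] [InnerProductSpace ℝ V] {p v : V}
    {A : ℝ} (hv : ‖v‖ ≤ A) : inner ℝ p v ≤ A * ‖p‖ := by
  calc inner ℝ p v ≤ ‖p‖ * ‖v‖ := real_inner_le_norm p v
    _ ≤ A * ‖p‖ := by rw [mul_comm]; gcongr

lemma exists_norm_le_inner_eq {V : Type*} [NormedAddCommGroup V] [InnerProductSpace ℝ V] (v : V)
    {A : ℝ} (hA : 0 ≤ A) : ∃ p : V, ‖p‖ ≤ A ∧ inner ℝ p v = A * ‖v‖ := by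
  rcases eq_or_ne v 0 with rfl | hv
  · exact ⟨0, by simpa using hA, by simp⟩
  · have hv' : ‖v‖ ≠ 0 := norm_ne_zero_iff.2 hv
    refine ⟨(A / ‖v‖) • v, le_of_eq ?_, ?_⟩
    · rw [norm_smul, norm_div, norm_norm, Real.norm_of_nonneg hA]
      field_simp
    · rw [real_inner_smul_left, real_inner_self_eq_norm_sq]
      field_simp

lemma mul_norm_add_le_of_forall_sphere {V : Type*} [NormedAddCommGroup V] [NormedSpace ℝ V]
    {f : V → ℝ} (hf : ConvexOn ℝ univ f) {A R : ℝ} (hR : 0 < R)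
    (hsphere : ∀ p, ‖p‖ = R → A * R + f 0 ≤ f p) {p : V} (hp : R ≤ ‖p‖) :
    A * ‖p‖ + f 0 ≤ f p := by
  have hp0 : 0 < ‖p‖ := hR.trans_le hp
  have hc0 : 0 < R / ‖p‖ := by positivity
  have hcp : R / ‖p‖ * ‖p‖ = R := div_mul_cancel₀ _ hp0.ne'
  have hscaled := hsphere ((R / ‖p‖) • p) (by rw [norm_smul, Real.norm_of_nonneg hc0.le, hcp])
  have hconvex := hf.2 (mem_univ p) (mem_univ 0) hc0.le (sub_nonneg.2 ((div_le_one hp0).2 hp))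
    (by ring)
  simp only [smul_zero, add_zero, smul_eq_mul] at hconvex
  refine le_of_mul_le_mul_left ?_ hc0
  calc R / ‖p‖ * (A * ‖p‖ + f 0) = A * (R / ‖p‖ * ‖p‖) + R / ‖p‖ * f 0 := by ring
    _ ≤ R / ‖p‖ * f p := by rw [hcp]; linarith

namespace IsConvexHamiltonian

variable {N m : ℕ} {H : Torus N → E N → (Fin m → ℝ) → ℝ} {Θ : ℝ≥0}

lemma continuous_at_zero (hH : IsConvexHamiltonian H) :
    Continuous fun q : Torus N × E N => H q.1 q.2 0 :=
  hH.continuous.comp (f := fun q : Torus N × E N => (q.1, q.2, (0 : Fin m → ℝ))) (by fun_prop)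

lemma exists_abs_le (hH : IsConvexHamiltonian H) (hΘ : ∀ x p, LipschitzWith Θ (H x p)) (R : ℝ) :
    ∃ B, 0 ≤ B ∧ ∀ x p u, ‖p‖ ≤ R → |H x p u| ≤ B + Θ * ‖u‖ := by
  obtain ⟨B, hB⟩ := (isCompact_univ.prod
    (isCompact_closedBall (0 : E N) R)).exists_bound_of_continuousOn
      hH.continuous_at_zero.continuousOn
  refine ⟨|B|, abs_nonneg B, fun x p u hp => ?_⟩
  calc |H x p u| ≤ |H x p 0| + |H x p u - H x p 0| := by
        simpa using abs_add_le (H x p 0) (H x p u - H x p 0)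
    _ ≤ |B| + Θ * ‖u‖ := add_le_add
        ((hB (x, p) ⟨trivial, by simpa using hp⟩).trans (le_abs_self B))
        (by simpa [Real.dist_eq] using (hΘ x p).dist_le_mul u 0)

lemma exists_eventually_mul_norm_add_le (hH : IsConvexHamiltonian H) (A : ℝ) (x₀ : Torus N) :
    ∃ R : ℝ, ∀ᶠ x in 𝓝 x₀, ∀ p, R ≤ ‖p‖ → A * ‖p‖ + H x 0 0 ≤ H x p 0 := by
  have hgrowth := (hH.superlinear x₀ 0).eventually_ge_atTop (A + 1 + |H x₀ 0 0|)
  obtain ⟨r, -, hr⟩ := (Metric.hasBasis_cobounded_compl_closedBall (0 : E N)).eventually_iff.1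
    hgrowth
  set R := max r 0 + 1
  have hR1 : 1 ≤ R := le_add_of_nonneg_left (le_max_right r 0)
  have hRr : r < R := (le_max_left r 0).trans_lt (lt_add_one _)
  have hsphere (p : E N) (hp : p ∈ Metric.sphere (0 : E N) R) : A * R + H x₀ 0 0 < H x₀ p 0 := by
    rw [mem_sphere_zero_iff_norm] at hp
    have hpr := hr (x := p) (by simp [hp, hRr])
    rw [hp, le_div_iff₀ (by linarith)] at hpr
    have habs : |H x₀ 0 0| ≤ |H x₀ 0 0| * R := le_mul_of_one_le_right (abs_nonneg _) hR1
    nlinarith [le_abs_self (H x₀ 0 0)]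
  have hcont : Continuous fun z : Torus N × E N => H z.1 z.2 0 - H z.1 0 0 :=
    hH.continuous_at_zero.sub (hH.continuous_at_zero.comp (by fun_prop : Continuous
      fun z : Torus N × E N => (z.1, (0 : E N))))
  have hnear : ∀ᶠ x in 𝓝 x₀, ∀ p ∈ Metric.sphere (0 : E N) R, A * R < H x p 0 - H x 0 0 :=
    (isCompact_sphere (0 : E N) R).eventually_forall_of_forall_eventually
      (P := fun x p => A * R < H x p 0 - H x 0 0) fun p hp =>
        hcont.continuousAt.eventually (lt_mem_nhds (lt_sub_iff_add_lt.2 (hsphere p hp)))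
  refine ⟨R, hnear.mono fun x hx p hp => ?_⟩
  refine mul_norm_add_le_of_forall_sphere (hH.convexOn x 0) (by linarith) (fun q hq => ?_) hp
  linarith [hx q (by simpa using hq)]

lemma exists_mul_norm_add_le (hH : IsConvexHamiltonian H) (A : ℝ) :
    ∃ R : ℝ, ∀ x p, R ≤ ‖p‖ → A * ‖p‖ + H x 0 0 ≤ H x p 0 := by
  suffices h : ∃ R : ℝ, ∀ x ∈ (univ : Set (Torus N)), ∀ p, R ≤ ‖p‖ →
      A * ‖p‖ + H x 0 0 ≤ H x p 0 by simpa using h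
  refine isCompact_univ.induction_on
    (p := fun s => ∃ R : ℝ, ∀ x ∈ s, ∀ p, R ≤ ‖p‖ → A * ‖p‖ + H x 0 0 ≤ H x p 0)
    ⟨0, by simp⟩ ?_ ?_ ?_
  · rintro s t hst ⟨R, h⟩
    exact ⟨R, fun x hx => h x (hst hx)⟩
  · rintro s t ⟨R, h⟩ ⟨R', h'⟩
    exact ⟨max R R', fun x hx p hp => hx.elim (fun hx => h x hx p ((le_max_left _ _).trans hp))
      fun hx => h' x hx p ((le_max_right _ _).trans hp)⟩
  · intro x _
    obtain ⟨R, h⟩ := hH.exists_eventually_mul_norm_add_le A x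
    exact ⟨_, nhdsWithin_le_nhds h, R, fun y hy => hy⟩

lemma exists_mul_norm_sub_le (hH : IsConvexHamiltonian H)
    (hΘ : ∀ x p, LipschitzWith Θ (H x p)) (A : ℝ) :
    ∃ C, 0 ≤ C ∧ ∀ x p u, A * ‖p‖ - C - Θ * ‖u‖ ≤ H x p u := by
  obtain ⟨R, hR⟩ := hH.exists_mul_norm_add_le A
  obtain ⟨B, hB0, hB⟩ := hH.exists_abs_le hΘ (max R 0)
  have hAR : 0 ≤ |A| * max R 0 := by positivity
  refine ⟨|A| * max R 0 + B, by positivity, fun x p u => ?_⟩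
  rcases le_total ‖p‖ (max R 0) with hp | hp
  · have hAp : A * ‖p‖ ≤ |A| * max R 0 := by gcongr; exact le_abs_self A
    linarith [abs_le.1 (hB x p u hp)]
  · have hlip := (hΘ x p).dist_le_mul 0 u
    rw [Real.dist_eq, dist_zero_left] at hlip
    have hzero := hB x 0 0 (by simp)
    rw [norm_zero, mul_zero, add_zero] at hzero
    linarith [hR x p ((le_max_left _ _).trans hp), (abs_le.1 hzero).1, (abs_le.1 hlip).2]

lemma bddAbove (hH : IsConvexHamiltonian H) (x : Torus N) (v : E N) (u : Fin m → ℝ) :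
    BddAbove (range fun p : E N => inner ℝ p v - H x p u) := by
  obtain ⟨Θ, hΘ⟩ := hH.lipschitz
  obtain ⟨C, -, hC⟩ := hH.exists_mul_norm_sub_le hΘ ‖v‖
  refine ⟨C + Θ * ‖u‖, forall_mem_range.2 fun p => ?_⟩
  linarith [hC x p u, inner_le_mul_norm (p := p) (le_refl ‖v‖)]

lemma inner_sub_le_lagrangian (hH : IsConvexHamiltonian H) (x : Torus N) (v p : E N)
    (u : Fin m → ℝ) : inner ℝ p v - H x p u ≤ lagrangian H x v u :=
  le_ciSup (hH.bddAbove x v u) p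

lemma lipschitzWith_lagrangian (hH : IsConvexHamiltonian H)
    (hΘ : ∀ x p, LipschitzWith Θ (H x p)) (x : Torus N) (v : E N) :
    LipschitzWith Θ (lagrangian H x v) :=
  LipschitzWith.of_le_add_mul Θ fun u u' => ciSup_le fun p => by
    have hp := (hΘ x p).dist_le_mul u u'
    rw [Real.dist_eq] at hp
    linarith [hH.inner_sub_le_lagrangian x v p u', neg_abs_le (H x p u - H x p u')]

lemma exists_le_lagrangian (hH : IsConvexHamiltonian H)
    (hΘ : ∀ x p, LipschitzWith Θ (H x p)) (A : ℝ) :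
    ∃ C, 0 ≤ C ∧ ∀ x v u, A * ‖v‖ - C - Θ * ‖u‖ ≤ lagrangian H x v u := by
  obtain ⟨B, hB0, hB⟩ := hH.exists_abs_le hΘ |A|
  refine ⟨B, hB0, fun x v u => ?_⟩
  obtain ⟨p, hp, hpv⟩ := exists_norm_le_inner_eq v (abs_nonneg A)
  have hAv : A * ‖v‖ ≤ |A| * ‖v‖ := by gcongr; exact le_abs_self A
  linarith [hH.inner_sub_le_lagrangian x v p u, (abs_le.1 (hB x p u hp)).2]

lemma exists_lagrangian_le (hH : IsConvexHamiltonian H)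
    (hΘ : ∀ x p, LipschitzWith Θ (H x p)) (R : ℝ) :
    ∃ C, 0 ≤ C ∧ ∀ x v u, ‖v‖ ≤ R → lagrangian H x v u ≤ C + Θ * ‖u‖ := by
  obtain ⟨C, hC0, hC⟩ := hH.exists_mul_norm_sub_le hΘ R
  refine ⟨C, hC0, fun x v u hv => ciSup_le fun p => ?_⟩
  linarith [hC x p u, inner_le_mul_norm (p := p) hv]

/-- On a ball, a large momentum is never optimal in the definition of the Lagrangian. -/
lemma exists_lagrangian_eq_sSup (hH : IsConvexHamiltonian H) (R : ℝ) :
    ∃ r, ∀ x v u, ‖v‖ ≤ R → ‖u‖ ≤ R →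
      lagrangian H x v u = sSup ((fun p => inner ℝ p v - H x p u) '' Metric.closedBall 0 r) := by
  obtain ⟨Θ, hΘ⟩ := hH.lipschitz
  obtain ⟨C, hC0, hC⟩ := hH.exists_mul_norm_sub_le hΘ (R + 1)
  obtain ⟨B, hB0, hB⟩ := hH.exists_abs_le hΘ 0
  set r := C + 2 * (Θ * |R|) + B
  refine ⟨r, fun x v u hv hu => ?_⟩
  have hzero : (0 : E N) ∈ Metric.closedBall 0 r := Metric.mem_closedBall_self (by positivity)
  have hbdd := (hH.bddAbove x v u).mono (image_subset_range _ (Metric.closedBall 0 r))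
  refine le_antisymm (ciSup_le fun p => ?_) (csSup_le ⟨_, 0, hzero, rfl⟩ ?_)
  · by_cases hp : p ∈ Metric.closedBall 0 r
    · exact le_csSup hbdd ⟨p, hp, rfl⟩
    · refine le_trans ?_ (le_csSup hbdd ⟨0, hzero, rfl⟩)
      have hΘu : Θ * ‖u‖ ≤ Θ * |R| := by gcongr; exact hu.trans (le_abs_self R)
      rw [mem_closedBall_zero_iff, not_le] at hp
      simp only [inner_zero_left]
      linarith [hC x p u, inner_le_mul_norm (p := p) hv, (abs_le.1 (hB x 0 u (by simp))).2]
  · rintro _ ⟨p, -, rfl⟩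
    exact hH.inner_sub_le_lagrangian x v p u

lemma continuous_lagrangian (hH : IsConvexHamiltonian H) :
    Continuous fun q : Torus N × E N × (Fin m → ℝ) => lagrangian H q.1 q.2.1 q.2.2 := by
  refine continuous_iff_continuousAt.2 fun q₀ => ?_
  obtain ⟨r, hr⟩ := hH.exists_lagrangian_eq_sSup (‖q₀.2‖ + 1)
  have hintegrand : Continuous fun q : (Torus N × E N × (Fin m → ℝ)) × E N =>
      inner ℝ q.2 q.1.2.1 - H q.1.1 q.2 q.1.2.2 :=
    Continuous.sub (by fun_prop) (hH.continuous.comp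
      (f := fun q : (Torus N × E N × (Fin m → ℝ)) × E N => (q.1.1, q.2, q.1.2.2)) (by fun_prop))
  have hsup := (isCompact_closedBall (0 : E N) r).continuous_sSup
    (f := fun (q : Torus N × E N × (Fin m → ℝ)) (p : E N) =>
      inner ℝ p q.2.1 - H q.1 p q.2.2) hintegrand
  refine hsup.continuousAt.congr ?_
  have hnorm : ∀ᶠ q : Torus N × E N × (Fin m → ℝ) in 𝓝 q₀, ‖q.2‖ < ‖q₀.2‖ + 1 :=
    (by fun_prop : Continuous fun q : Torus N × E N × (Fin m → ℝ) => ‖q.2‖).continuousAt.eventually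
      (gt_mem_nhds (lt_add_one _))
  filter_upwards [hnorm] with q hq
  exact (hr _ _ _ ((norm_fst_le _).trans hq.le) ((norm_snd_le _).trans hq.le)).symm

lemma add_le_zero_of_forall_le_lagrangian (hH : IsConvexHamiltonian H) {x : Torus N} {p : E N}
    {u : Fin m → ℝ} {a : ℝ} (h : ∀ v, a + inner ℝ p v ≤ lagrangian H x v u) :
    a + H x p u ≤ 0 := by
  by_contra! hlt
  obtain ⟨b, hab, hb⟩ := exists_between (neg_lt_iff_pos_add'.2 hlt)
  have hcont : Continuous fun q : E N => H x q u :=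
    hH.continuous.comp (f := fun q : E N => (x, q, u)) (by fun_prop)
  obtain ⟨l, c, hle, heq⟩ := (hH.convexOn x u).exists_affine_le_of_lt (𝕜 := ℝ) (mem_univ p)
    hb isClosed_univ (hcont.lowerSemicontinuous.lowerSemicontinuousOn _)
  have hl (q : E N) : inner ℝ q ((InnerProductSpace.toDual ℝ (E N)).symm l) = l q := by
    rw [real_inner_comm, InnerProductSpace.toDual_symm_apply]
  have hlagrangian : lagrangian H x ((InnerProductSpace.toDual ℝ (E N)).symm l) u ≤ -c :=
    ciSup_le fun q => by
      have hq : l q + c ≤ H x q u := hle ⟨q, mem_univ q⟩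
      linarith [hl q]
  have hp : l p + c = b := heq
  linarith [h ((InnerProductSpace.toDual ℝ (E N)).symm l), hl p]

end IsConvexHamiltonian

/-! ### The Lax-Oleinik operator -/

section LaxOleinik

variable {N m : ℕ}

/-- The running cost `L(x, v, u(x, s))` of the Lax-Oleinik formula, lifted to `ℝ^N`. -/
def cost (H : Torus N → E N → (Fin m → ℝ) → ℝ) (u : C(Torus N × ℝ≥0, Fin m → ℝ))
    (x v : E N) (s : ℝ) : ℝ :=
  lagrangian H (proj x) v (u (proj x, s.toNNReal))

/-- The infimum in the implicit Lax-Oleinik formula for the component `i`, when `u` is inserted in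
the Lagrangian; as a function on `ℝ^N × [0, ∞)`. -/
def laxOleinik (H : Fin m → Torus N → E N → (Fin m → ℝ) → ℝ) (φ : C(Torus N, Fin m → ℝ))
    (u : C(Torus N × ℝ≥0, Fin m → ℝ)) (i : Fin m) (x : E N) (t : ℝ) : ℝ :=
  value (cost (H i) u) (fun y => φ (proj y) i) 0 x t

lemma continuous_lift (u : C(Torus N × ℝ≥0, Fin m → ℝ)) :
    Continuous fun q : E N × ℝ => u (proj q.1, q.2.toNNReal) :=
  u.continuous.comp (((continuous_proj N).comp continuous_fst).prodMk
    (continuous_real_toNNReal.comp continuous_snd))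

lemma isCompact_univ_prod_Icc (N : ℕ) (T : ℝ) :
    IsCompact ((univ : Set (Torus N)) ×ˢ Icc (0 : ℝ≥0) T.toNNReal) :=
  isCompact_univ.prod isCompact_Icc

lemma mk_toNNReal_mem (x : Torus N) {s T : ℝ} (hs : s ≤ T) :
    (x, s.toNNReal) ∈ (univ : Set (Torus N)) ×ˢ Icc (0 : ℝ≥0) T.toNNReal :=
  ⟨trivial, zero_le, Real.toNNReal_le_toNNReal hs⟩

lemma exists_norm_le (u : C(Torus N × ℝ≥0, Fin m → ℝ)) (T : ℝ) :
    ∃ B, 0 ≤ B ∧ ∀ x, ∀ s ≤ T, ‖u (x, s.toNNReal)‖ ≤ B := by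
  obtain ⟨B, hB⟩ := (isCompact_univ_prod_Icc N T).exists_bound_of_continuousOn
    u.continuous.continuousOn
  exact ⟨|B|, abs_nonneg B, fun x s hs => (hB _ (mk_toNNReal_mem x hs)).trans (le_abs_self B)⟩

lemma exists_norm_sub_le_of_time (u : C(Torus N × ℝ≥0, Fin m → ℝ)) (T : ℝ) {ε : ℝ} (hε : 0 < ε) :
    ∃ δ > 0, ∀ x, ∀ s ≤ T, ∀ r ≤ T, |s - r| ≤ δ →
      ‖u (x, s.toNNReal) - u (x, r.toNNReal)‖ ≤ ε := by
  obtain ⟨δ, hδ, hu⟩ := Metric.uniformContinuousOn_iff.1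
    ((isCompact_univ_prod_Icc N T).uniformContinuousOn_of_continuous u.continuous.continuousOn) ε hε
  refine ⟨δ / 2, half_pos hδ, fun x s hs r hr hsr => ?_⟩
  rw [← dist_eq_norm]
  refine (hu _ (mk_toNNReal_mem x hs) _ (mk_toNNReal_mem x hr) ?_).le
  have hdist : dist s.toNNReal r.toNNReal ≤ |s - r| := by
    simpa [Real.dist_eq] using Real.lipschitzWith_toNNReal.dist_le_mul s r
  rw [Prod.dist_eq, dist_self, max_lt_iff]
  exact ⟨hδ, by linarith⟩

lemma IsConvexHamiltonian.abs_cost_sub_le {H : Torus N → E N → (Fin m → ℝ) → ℝ} {Θ : ℝ≥0}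
    (hH : IsConvexHamiltonian H) (hΘ : ∀ x p, LipschitzWith Θ (H x p))
    (u u' : C(Torus N × ℝ≥0, Fin m → ℝ)) (x v : E N) (s r : ℝ) :
    |cost H u x v s - cost H u' x v r| ≤
      Θ * ‖u (proj x, s.toNNReal) - u' (proj x, r.toNNReal)‖ := by
  rw [← Real.dist_eq, ← dist_eq_norm]
  exact (hH.lipschitzWith_lagrangian hΘ (proj x) v).dist_le_mul _ _

lemma IsConvexHamiltonian.isTonelliCost {H : Torus N → E N → (Fin m → ℝ) → ℝ}
    (hH : IsConvexHamiltonian H) (u : C(Torus N × ℝ≥0, Fin m → ℝ)) :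
    IsTonelliCost (cost H u) where
  continuous := by
    have hproj : Continuous fun q : E N × E N × ℝ => proj q.1 :=
      (continuous_proj N).comp continuous_fst
    have hu : Continuous fun q : E N × E N × ℝ => u (proj q.1, q.2.2.toNNReal) :=
      (continuous_lift u).comp (f := fun q : E N × E N × ℝ => (q.1, q.2.2)) (by fun_prop)
    exact hH.continuous_lagrangian.comp
      (f := fun q : E N × E N × ℝ => (proj q.1, q.2.1, u (proj q.1, q.2.2.toNNReal)))
      (hproj.prodMk ((by fun_prop : Continuous fun q : E N × E N × ℝ => q.2.1).prodMk hu))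
  superlinear A T := by
    obtain ⟨Θ, hΘ⟩ := hH.lipschitz
    obtain ⟨B, hB0, hB⟩ := exists_norm_le u T
    obtain ⟨C, hC0, hC⟩ := hH.exists_le_lagrangian hΘ A
    refine ⟨C + Θ * B, by positivity, fun x v s hs => ?_⟩
    have hΘu : Θ * ‖u (proj x, s.toNNReal)‖ ≤ Θ * B := by gcongr; exact hB _ s hs
    have hle : A * ‖v‖ - C - Θ * ‖u (proj x, s.toNNReal)‖ ≤ cost H u x v s := hC _ _ _
    linarith
  bounded R T := by
    obtain ⟨Θ, hΘ⟩ := hH.lipschitz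
    obtain ⟨B, hB0, hB⟩ := exists_norm_le u T
    obtain ⟨C, hC0, hC⟩ := hH.exists_lagrangian_le hΘ R
    refine ⟨C + Θ * B, by positivity, fun x v hv s hs => (hC _ v _ hv).trans ?_⟩
    gcongr
    exact hB _ s hs
  timeModulus T ε hε := by
    obtain ⟨Θ, hΘ⟩ := hH.lipschitz
    obtain ⟨δ, hδ, hu⟩ := exists_norm_sub_le_of_time u T (ε := ε / (Θ + 1)) (by positivity)
    refine ⟨δ, hδ, fun x v s hs r hr hsr => ?_⟩
    calc |cost H u x v s - cost H u x v r|
        ≤ Θ * ‖u (proj x, s.toNNReal) - u (proj x, r.toNNReal)‖ := hH.abs_cost_sub_le hΘ u u x v s r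
      _ ≤ (Θ + 1) * (ε / (Θ + 1)) := by
          gcongr
          · simp
          · exact hu (proj x) s hs r hr hsr
      _ = ε := by field_simp

variable {H : Fin m → Torus N → E N → (Fin m → ℝ) → ℝ} {φ : C(Torus N, Fin m → ℝ)}
  {u : C(Torus N × ℝ≥0, Fin m → ℝ)} {i : Fin m}

lemma exists_lipschitzWith (hH : ∀ i, IsConvexHamiltonian (H i)) :
    ∃ Θ : ℝ≥0, 0 < Θ ∧ ∀ i x p, LipschitzWith Θ (H i x p) := by
  choose θ hθ using fun i => (hH i).lipschitz
  refine ⟨∑ i, θ i + 1, by positivity, fun i x p => (hθ i x p).weaken ?_⟩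
  exact (Finset.single_le_sum (fun _ _ => zero_le) (Finset.mem_univ i)).trans le_self_add

lemma abs_datum_le (φ : C(Torus N, Fin m → ℝ)) (i : Fin m) (y : E N) : |φ (proj y) i| ≤ ‖φ‖ :=
  (norm_le_pi_norm (φ (proj y)) i).trans (φ.norm_coe_le_norm _)

lemma uniformContinuous_datum (φ : C(Torus N, Fin m → ℝ)) (i : Fin m) :
    UniformContinuous fun y : E N => φ (proj y) i :=
  (CompactSpace.uniformContinuous_of_continuous
    ((continuous_apply i).comp φ.continuous)).comp (lipschitzWith_proj N).uniformContinuous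

/-- A curve on the torus may be lifted so as to end at any prescribed representative of its
endpoint. -/
lemma actionValues_proj (H : Fin m → Torus N → E N → (Fin m → ℝ) → ℝ)
    (φ : C(Torus N, Fin m → ℝ)) (u : C(Torus N × ℝ≥0, Fin m → ℝ)) (i : Fin m) (x : E N)
    (t : ℝ≥0) :
    actionValues H φ u i (proj x) t =
      payoffs (cost (H i) u) (fun y => φ (proj y) i) 0 x t := by
  refine Subset.antisymm ?_ ?_
  · rintro _ ⟨γ, hγ, hx, h_int, rfl⟩
    set σ : ℝ → E N := fun s => γ s + (x - γ t)
    have hσ : AbsolutelyContinuousOnInterval σ 0 t :=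
      absolutelyContinuousOnInterval_of_dist_le (K := 1) hγ fun s _ r _ => by simp [σ]
    have hprojσ (s : ℝ) : proj (σ s) = proj (γ s) := by
      simp only [σ, proj_add, proj_sub, hx, sub_self, add_zero]
    have hcost : (fun s => cost (H i) u (σ s) (deriv σ s) s) = lagrangianAlong (H i) u γ := by
      funext s
      simp only [cost, lagrangianAlong, hprojσ, σ, deriv_add_const]
    refine ⟨σ, ⟨hσ, hcost ▸ h_int⟩, add_sub_cancel _ _, ?_⟩
    simp only [hprojσ, action, hcost]
  · rintro _ ⟨γ, hγ, hx, rfl⟩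
    exact ⟨γ, hγ.absolutelyContinuous, congrArg proj hx, hγ.intervalIntegrable, rfl⟩

lemma isGLB_laxOleinik (hH : ∀ i, IsConvexHamiltonian (H i)) (x : E N) (t : ℝ≥0) :
    IsGLB (actionValues H φ u i (proj x) t) (laxOleinik H φ u i x t) := by
  rw [actionValues_proj]
  exact ((hH i).isTonelliCost u).isGLB_value (abs_datum_le φ i) x t.2

lemma isVariationalSolution_iff (hH : ∀ i, IsConvexHamiltonian (H i)) :
    IsVariationalSolution H φ u ↔ ∀ i x (t : ℝ≥0), u (proj x, t) i = laxOleinik H φ u i x t := by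
  refine ⟨fun h i x t => (h i (proj x) t).unique (isGLB_laxOleinik hH x t), fun h i x t => ?_⟩
  obtain ⟨x, rfl⟩ := proj_surjective N x
  rw [h]
  exact isGLB_laxOleinik hH x t

lemma IsVariationalSolution.eq_laxOleinik (hu : IsVariationalSolution H φ u)
    (hH : ∀ i, IsConvexHamiltonian (H i)) (i : Fin m) (x : E N) {t : ℝ} (ht : 0 ≤ t) :
    u (proj x, t.toNNReal) i = laxOleinik H φ u i x t := by
  rw [(isVariationalSolution_iff hH).1 hu, Real.coe_toNNReal t ht]

/-- The Lax-Oleinik operator `u ↦ laxOleinik H φ u`, acting on the continuous functions on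
`𝕋^N × [0, ∞)`; its fixed points are the variational solutions. -/
def laxOleinikMap (hH : ∀ i, IsConvexHamiltonian (H i)) (φ : C(Torus N, Fin m → ℝ))
    (u : C(Torus N × ℝ≥0, Fin m → ℝ)) : C(Torus N × ℝ≥0, Fin m → ℝ) where
  toFun q i := sInf (actionValues H φ u i q.1 q.2)
  continuous_toFun := by
    rw [← ((isOpenQuotientMap_proj N).prodMap IsOpenQuotientMap.id).continuous_comp_iff]
    refine continuous_pi fun i => (((hH i).isTonelliCost u).continuous_value (abs_datum_le φ i)
      (uniformContinuous_datum φ i)).congr fun q => ?_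
    exact congrArg sInf (actionValues_proj H φ u i q.1 q.2).symm

lemma laxOleinikMap_apply (hH : ∀ i, IsConvexHamiltonian (H i)) (φ : C(Torus N, Fin m → ℝ))
    (u : C(Torus N × ℝ≥0, Fin m → ℝ)) (x : E N) (t : ℝ≥0) (i : Fin m) :
    laxOleinikMap hH φ u (proj x, t) i = laxOleinik H φ u i x t :=
  congrArg sInf (actionValues_proj H φ u i x t)

lemma IsVariationalSolution.of_laxOleinikMap_eq (hH : ∀ i, IsConvexHamiltonian (H i))
    (hu : laxOleinikMap hH φ u = u) : IsVariationalSolution H φ u :=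
  (isVariationalSolution_iff hH).2 fun i x t => by
    rw [← laxOleinikMap_apply hH, hu]

end LaxOleinik

section FixedPoint

open BoundedContinuousFunction

variable {N m : ℕ} {H : Fin m → Torus N → E N → (Fin m → ℝ) → ℝ} {φ : C(Torus N, Fin m → ℝ)}
  {u u' : C(Torus N × ℝ≥0, Fin m → ℝ)} {i : Fin m} {Θ : ℝ≥0}

lemma hasDerivAt_half_mul_exp (c d t : ℝ) :
    HasDerivAt (fun s => d / 2 * Real.exp (2 * c * s)) (c * (d * Real.exp (2 * c * t))) t := by
  have hexp := (((hasDerivAt_id t).const_mul (2 * c)).exp).const_mul (d / 2)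
  exact hexp.congr_deriv (by simp only [id, mul_one]; ring)

lemma mul_integral_exp_le (c : ℝ) {d : ℝ} (hd : 0 ≤ d) (t : ℝ) :
    ∫ s in (0 : ℝ)..t, c * (d * Real.exp (2 * c * s)) ≤ d / 2 * Real.exp (2 * c * t) := by
  rw [intervalIntegral.integral_eq_sub_of_hasDerivAt (fun s _ => hasDerivAt_half_mul_exp c d s)
    (Continuous.intervalIntegrable (by fun_prop) _ _), mul_zero, Real.exp_zero, mul_one]
  exact sub_le_self _ (by positivity)

lemma laxOleinik_le_add_integral (hH : ∀ i, IsConvexHamiltonian (H i))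
    (hΘ : ∀ i x p, LipschitzWith Θ (H i x p)) (x : E N) {t : ℝ} (ht : 0 ≤ t) {e : ℝ → ℝ}
    (he : Continuous e)
    (hu : ∀ x, ∀ s ∈ Icc 0 t, ‖u' (x, s.toNNReal) - u (x, s.toNNReal)‖ ≤ e s) :
    laxOleinik H φ u' i x t ≤ laxOleinik H φ u i x t + ∫ s in (0 : ℝ)..t, Θ * e s :=
  ((hH i).isTonelliCost u).value_le_value_add_integral ((hH i).isTonelliCost u')
    (abs_datum_le φ i) x ht (by fun_prop) fun y v s hs =>
      ((hH i).abs_cost_sub_le (hΘ i) u' u y v s s).trans (by gcongr; exact hu _ s hs)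

/-- The exponential weight turns the Lax-Oleinik operator into a contraction of ratio `1/2`. -/
lemma abs_laxOleinik_sub_le (hH : ∀ i, IsConvexHamiltonian (H i))
    (hΘ : ∀ i x p, LipschitzWith Θ (H i x p)) (x : E N) {t : ℝ} (ht : 0 ≤ t) {d : ℝ} (hd : 0 ≤ d)
    (hu : ∀ x, ∀ s ∈ Icc 0 t,
      ‖u' (x, s.toNNReal) - u (x, s.toNNReal)‖ ≤ d * Real.exp (2 * Θ * s)) :
    |laxOleinik H φ u' i x t - laxOleinik H φ u i x t| ≤ d / 2 * Real.exp (2 * Θ * t) := by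
  have hle := laxOleinik_le_add_integral (φ := φ) (i := i) hH hΘ x ht (by fun_prop) hu
  have hge := laxOleinik_le_add_integral (φ := φ) (i := i) hH hΘ x ht (by fun_prop)
    fun x s hs => (norm_sub_rev _ _).trans_le (hu x s hs)
  have h_int := mul_integral_exp_le Θ hd t
  exact abs_le.2 ⟨by linarith, by linarith⟩

lemma exists_abs_laxOleinik_zero_le (hH : ∀ i, IsConvexHamiltonian (H i)) (hΘ : 0 < Θ)
    (φ : C(Torus N, Fin m → ℝ)) (i : Fin m) :
    ∃ K, 0 ≤ K ∧ ∀ x (t : ℝ≥0), |laxOleinik H φ 0 i x t| ≤ K * Real.exp (2 * Θ * t) := by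
  have hcost := (hH i).isTonelliCost 0
  obtain ⟨C₁, hC₁, hlow⟩ := hcost.superlinear 0 0
  obtain ⟨C₂, hC₂, hup⟩ := hcost.bounded 0 0
  refine ⟨‖φ‖ + (C₁ + C₂) / (2 * Θ), by positivity, fun x t => ?_⟩
  have hcost0 (y v : E N) (s : ℝ) : cost (H i) 0 y v s = cost (H i) 0 y v 0 := rfl
  calc |laxOleinik H φ 0 i x t| ≤ ‖φ‖ + (C₁ + C₂) * (t - 0) :=
        hcost.abs_value_le (abs_datum_le φ i) x t.2
          (fun y v s _ => by linarith [hcost0 y v s, hlow y v 0 le_rfl])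
          fun y s _ => by linarith [hcost0 y 0 s, hup y 0 (by simp) 0 le_rfl]
    _ = ‖φ‖ * 1 + (C₁ + C₂) / (2 * Θ) * (2 * Θ * t) := by field_simp; ring
    _ ≤ ‖φ‖ * Real.exp (2 * Θ * t) + (C₁ + C₂) / (2 * Θ) * Real.exp (2 * Θ * t) := by
        gcongr
        · exact Real.one_le_exp (by positivity)
        · linarith [Real.add_one_le_exp (2 * Θ * t : ℝ)]
    _ = (‖φ‖ + (C₁ + C₂) / (2 * Θ)) * Real.exp (2 * Θ * t) := by ring

/-- The function `e^{c t} w(x, t)`. The functions of this form, with `w` bounded, are a space on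
which the Lax-Oleinik operator acts for large `c`. -/
def weighted (c : ℝ) (w : Torus N × ℝ≥0 →ᵇ (Fin m → ℝ)) : C(Torus N × ℝ≥0, Fin m → ℝ) where
  toFun q := Real.exp (c * q.2) • w q
  continuous_toFun := by fun_prop

lemma norm_weighted_sub_le (c : ℝ) (w w' : Torus N × ℝ≥0 →ᵇ (Fin m → ℝ)) (x : Torus N) {s : ℝ}
    (hs : 0 ≤ s) :
    ‖weighted c w (x, s.toNNReal) - weighted c w' (x, s.toNNReal)‖ ≤
      ‖w - w'‖ * Real.exp (c * s) := by
  lift s to ℝ≥0 using hs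
  calc ‖weighted c w (x, (s : ℝ).toNNReal) - weighted c w' (x, (s : ℝ).toNNReal)‖
      = ‖Real.exp (c * s) • (w - w') (x, s)‖ := by simp [weighted, smul_sub]
    _ = ‖(w - w') (x, s)‖ * Real.exp (c * s) := by
        rw [norm_smul, Real.norm_of_nonneg (Real.exp_nonneg _), mul_comm]
    _ ≤ ‖w - w'‖ * Real.exp (c * s) := by gcongr; exact (w - w').norm_coe_le_norm _

lemma abs_laxOleinik_weighted_sub_le (hH : ∀ i, IsConvexHamiltonian (H i))
    (hΘ : ∀ i x p, LipschitzWith Θ (H i x p)) (w w' : Torus N × ℝ≥0 →ᵇ (Fin m → ℝ)) (x : E N)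
    (t : ℝ≥0) :
    |laxOleinik H φ (weighted (2 * Θ) w) i x t - laxOleinik H φ (weighted (2 * Θ) w') i x t| ≤
      ‖w - w'‖ / 2 * Real.exp (2 * Θ * t) :=
  abs_laxOleinik_sub_le hH hΘ x t.2 (norm_nonneg _) fun y _ hs =>
    norm_weighted_sub_le (2 * Θ) w w' y hs.1

lemma exists_abs_laxOleinik_weighted_le (hH : ∀ i, IsConvexHamiltonian (H i))
    (hΘ0 : 0 < Θ) (hΘ : ∀ i x p, LipschitzWith Θ (H i x p)) (φ : C(Torus N, Fin m → ℝ))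
    (w : Torus N × ℝ≥0 →ᵇ (Fin m → ℝ)) :
    ∃ B, 0 ≤ B ∧ ∀ i x (t : ℝ≥0),
      |laxOleinik H φ (weighted (2 * Θ) w) i x t| ≤ B * Real.exp (2 * Θ * t) := by
  choose K hK0 hK using exists_abs_laxOleinik_zero_le hH hΘ0 φ
  have hweighted : weighted (2 * Θ) (0 : Torus N × ℝ≥0 →ᵇ (Fin m → ℝ)) = 0 := by
    ext; simp [weighted]
  refine ⟨‖w‖ / 2 + ∑ i, K i, add_nonneg (by positivity) (Finset.sum_nonneg fun i _ => hK0 i),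
    fun i x t => ?_⟩
  have hdiff := abs_laxOleinik_weighted_sub_le (φ := φ) (i := i) hH hΘ w 0 x t
  rw [hweighted, sub_zero] at hdiff
  have hsum : K i * Real.exp (2 * Θ * t) ≤ (∑ i, K i) * Real.exp (2 * Θ * t) := by
    gcongr
    exact Finset.single_le_sum (fun j _ => hK0 j) (Finset.mem_univ i)
  linarith [hK i x t, abs_sub_abs_le_abs_sub (laxOleinik H φ (weighted (2 * Θ) w) i x t)
    (laxOleinik H φ 0 i x t)]

lemma norm_exp_neg_smul_laxOleinikMap_le (hH : ∀ i, IsConvexHamiltonian (H i)) {B c : ℝ}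
    (hB : 0 ≤ B) (h : ∀ i x (t : ℝ≥0), |laxOleinik H φ u i x t| ≤ B * Real.exp (c * t))
    (q : Torus N × ℝ≥0) : ‖Real.exp (-(c * q.2)) • laxOleinikMap hH φ u q‖ ≤ B := by
  obtain ⟨x, t⟩ := q
  obtain ⟨x, rfl⟩ := proj_surjective N x
  rw [norm_smul, Real.norm_of_nonneg (Real.exp_nonneg _), Real.exp_neg,
    inv_mul_le_iff₀ (Real.exp_pos _), mul_comm, pi_norm_le_iff_of_nonneg (by positivity)]
  exact fun i => by simpa only [laxOleinikMap_apply, Real.norm_eq_abs] using h i x t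

theorem exists_isVariationalSolution (hH : ∀ i, IsConvexHamiltonian (H i))
    (φ : C(Torus N, Fin m → ℝ)) : ∃ u, IsVariationalSolution H φ u := by
  obtain ⟨Θ, hΘ0, hΘ⟩ := exists_lipschitzWith hH
  choose B hB0 hB using exists_abs_laxOleinik_weighted_le hH hΘ0 hΘ φ
  let F : (Torus N × ℝ≥0 →ᵇ (Fin m → ℝ)) → (Torus N × ℝ≥0 →ᵇ (Fin m → ℝ)) := fun w =>
    ofNormedAddCommGroup
      (fun q => Real.exp (-(2 * Θ * q.2)) • laxOleinikMap hH φ (weighted (2 * Θ) w) q)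
      (by fun_prop) (B w) (norm_exp_neg_smul_laxOleinikMap_le hH (hB0 w) (hB w))
  have hF_apply (w : Torus N × ℝ≥0 →ᵇ (Fin m → ℝ)) (q : Torus N × ℝ≥0) :
      laxOleinikMap hH φ (weighted (2 * Θ) w) q = weighted (2 * Θ) (F w) q := by
    simp [weighted, F, smul_smul, ← Real.exp_add]
  have hF : ContractingWith (1 / 2) F := by
    refine ⟨by norm_num, LipschitzWith.of_dist_le_mul fun w w' => ?_⟩
    rw [BoundedContinuousFunction.dist_le (by positivity)]
    rintro ⟨x, t⟩
    obtain ⟨x, rfl⟩ := proj_surjective N x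
    rw [dist_pi_le_iff (by positivity)]
    intro i
    have hdiff := abs_laxOleinik_weighted_sub_le (φ := φ) (i := i) hH hΘ w w' x t
    rw [← laxOleinikMap_apply hH, ← laxOleinikMap_apply hH, hF_apply, hF_apply] at hdiff
    simp only [weighted, ContinuousMap.coe_mk, Pi.smul_apply, smul_eq_mul, ← mul_sub, abs_mul,
      abs_of_pos (Real.exp_pos _)] at hdiff
    rw [mul_comm, mul_le_mul_iff_left₀ (Real.exp_pos _)] at hdiff
    simpa [Real.dist_eq, dist_eq_norm, div_eq_inv_mul] using hdiff
  obtain ⟨w, hw, -⟩ := hF.exists_fixedPoint 0 (edist_ne_top _ _)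
  refine ⟨weighted (2 * Θ) w, .of_laxOleinikMap_eq hH (ContinuousMap.ext fun q => ?_)⟩
  rw [hF_apply, hw]

end FixedPoint

/-! ### Variational solutions are viscosity solutions -/

lemma nonneg_of_eventually_le_left {f : ℝ → ℝ} {f' t : ℝ} (hf : HasDerivAt f f' t)
    (h : ∀ᶠ s in 𝓝[<] t, f s ≤ f t) : 0 ≤ f' := by
  have hslope : Tendsto (slope f t) (𝓝[<] t) (𝓝 f') :=
    (hasDerivWithinAt_iff_tendsto_slope' (by simp)).1 (hf.hasDerivWithinAt (s := Iio t))
  refine ge_of_tendsto hslope ?_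
  filter_upwards [h, self_mem_nhdsWithin] with s hs hst
  rw [slope_def_field]
  exact div_nonneg_of_nonpos (sub_nonpos.2 hs) (sub_nonpos.2 (le_of_lt hst))

section Touching

variable {V : Type*} [NormedAddCommGroup V] [NormedSpace ℝ V] {ℓ : V → V → ℝ → ℝ} {g : V → ℝ}
  {γ : ℝ → V} {a b t G : ℝ} {x : V} {ψ : V × ℝ → ℝ}

namespace IsTonelliCost

lemma fderiv_le_of_isLocalMax (hℓ : IsTonelliCost ℓ) (hG : ∀ x, |g x| ≤ G) (hat : a < t)
    (hψ : DifferentiableAt ℝ ψ (x, t))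
    (hmax : IsLocalMax (fun q : V × ℝ => value ℓ g a q.1 q.2 - ψ q) (x, t)) (v : V) :
    fderiv ℝ ψ (x, t) (v, 1) ≤ ℓ x v t := by
  let line : ℝ → V × ℝ := fun τ => (x + (τ - t) • v, τ)
  have hline_t : line t = (x, t) := by simp [line]
  have hline : HasDerivAt line (v, 1) t := by
    refine HasDerivAt.prodMk ?_ (hasDerivAt_id t)
    simpa using (((hasDerivAt_id t).sub_const t).smul_const v).const_add x
  have hcost : Continuous fun s => ℓ (x + (s - t) • v) v s :=
    hℓ.continuous.comp (f := fun s : ℝ => (x + (s - t) • v, v, s)) (by fun_prop)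
  have h_int : HasDerivAt (fun τ => ∫ s in t..τ, ℓ (x + (s - t) • v) v s) (ℓ x v t) t := by
    simpa using intervalIntegral.integral_hasDerivAt_right (hcost.intervalIntegrable t t)
      (hcost.stronglyMeasurableAtFilter _ _) hcost.continuousAt
  have hψline : HasDerivAt (ψ ∘ line) (fderiv ℝ ψ (x, t) (v, 1)) t := by
    rw [← hline_t] at hψ ⊢
    exact hψ.hasFDerivAt.comp_hasDerivAt t hline
  have hle : ∀ᶠ τ in 𝓝 t, value ℓ g a (line τ).1 τ - ψ (line τ) ≤ value ℓ g a x t - ψ (x, t) :=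
    (hline_t ▸ hline.continuousAt.tendsto : Tendsto line (𝓝 t) (𝓝 (x, t))).eventually hmax
  refine sub_nonneg.1 (nonneg_of_eventually_le_left (h_int.sub hψline) ?_)
  filter_upwards [nhdsWithin_le_nhds hle, nhdsWithin_le_nhds (Ioi_mem_nhds hat),
    self_mem_nhdsWithin] with τ hτ haτ hτt
  have hdpp := hℓ.value_le_value_add_action hG (le_of_lt haτ) (le_of_lt hτt)
    (isFiniteActionCurve_affine hℓ.continuous x v τ t t)
  rw [action_affine, sub_self, zero_smul, add_zero, intervalIntegral.integral_symm] at hdpp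
  simp only [Pi.sub_apply, Function.comp_apply, hline_t, intervalIntegral.integral_same]
  simp only [line] at hτ ⊢
  linarith

variable [FiniteDimensional ℝ V]

lemma exists_norm_sub_lt_of_near_optimal (hℓ : IsTonelliCost ℓ) (hG : ∀ x, |g x| ≤ G) (a t : ℝ)
    {r : ℝ} (hr : 0 < r) :
    ∃ h > 0, ∀ b ∈ Icc a t, t - b ≤ h → ∀ γ, IsFiniteActionCurve ℓ γ b t →
      value ℓ g a (γ b) b + action ℓ γ b t ≤ value ℓ g a (γ t) t + 1 → ‖γ t - γ b‖ < r := by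
  obtain ⟨B, hB⟩ := hℓ.exists_abs_value_le hG a t
  set A := (2 * |B| + 3) / r
  have hA : A * r = 2 * |B| + 3 := div_mul_cancel₀ _ hr.ne'
  obtain ⟨C, hC0, hC⟩ := hℓ.superlinear A t
  refine ⟨1 / (C + 1), by positivity, fun b hb hbt γ hγ hopt => ?_⟩
  have hspeed := mul_norm_sub_le_action hγ hb.2 (by positivity) hC
  have hCh : C * (t - b) ≤ 1 := by
    rw [le_div_iff₀ (by positivity)] at hbt
    linarith [hb.2]
  have hvb := abs_le.1 ((hB (γ b) b hb).trans (le_abs_self B))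
  have hvt := abs_le.1 ((hB (γ t) t ⟨hb.1.trans hb.2, le_rfl⟩).trans (le_abs_self B))
  refine lt_of_mul_lt_mul_left (a := A) ?_ (by positivity)
  linarith

lemma exists_near_optimal_of_mem_nhds (hℓ : IsTonelliCost ℓ) (hG : ∀ x, |g x| ≤ G) (hat : a < t)
    {s : Set (V × ℝ)} (hs : s ∈ 𝓝 (x, t)) :
    ∃ b ∈ Ico a t, ∀ ε > 0, ∃ γ, IsFiniteActionCurve ℓ γ b t ∧ γ t = x ∧
      value ℓ g a (γ b) b + action ℓ γ b t ≤ value ℓ g a x t + ε ∧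
      ∀ τ ∈ Icc b t, (γ τ, τ) ∈ s := by
  obtain ⟨r, hr, hball⟩ := Metric.mem_nhds_iff.1 hs
  obtain ⟨h, hh, hnear⟩ := hℓ.exists_norm_sub_lt_of_near_optimal hG a t hr
  have hd : 0 < min h (min (r / 2) (t - a)) :=
    lt_min hh (lt_min (half_pos hr) (sub_pos.2 hat))
  set d := min h (min (r / 2) (t - a))
  have hdh : d ≤ h := min_le_left _ _
  have hdr : d ≤ r / 2 := (min_le_right _ _).trans (min_le_left _ _)
  have hda : d ≤ t - a := (min_le_right _ _).trans (min_le_right _ _)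
  have hab : a ≤ t - d := by linarith
  refine ⟨t - d, ⟨hab, by linarith⟩, fun ε hε => ?_⟩
  obtain ⟨B, hB⟩ := hℓ.exists_abs_value_le hG a (t - d)
  obtain ⟨γ, hγ, rfl, hopt⟩ := hℓ.exists_lt_value_add (fun y => hB y (t - d) ⟨hab, le_rfl⟩) x
    (by linarith : t - d ≤ t) (lt_min one_pos hε)
  rw [hℓ.value_value hG _ hab (by linarith)] at hopt
  refine ⟨γ, hγ, rfl, by linarith [min_le_right 1 ε], fun τ hτ => hball ?_⟩
  have hsplit := hγ.action_add_action hτ.1 hτ.2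
  have hdpp := hℓ.value_le_value_add_action hG hab hτ.1 (hγ.left hτ.1 hτ.2)
  have hclose := hnear τ ⟨hab.trans hτ.1, hτ.2⟩ (by linarith [hτ.1]) γ (hγ.right hτ.1 hτ.2)
    (by linarith [min_le_left 1 ε])
  rw [Metric.mem_ball, Prod.dist_eq, max_lt_iff, dist_comm, dist_eq_norm, Real.dist_eq, abs_lt]
  exact ⟨hclose, by linarith [hτ.1], by linarith [hτ.2]⟩

end IsTonelliCost

lemma sub_le_action_sub_of_fderiv_le [FiniteDimensional ℝ V] (hγ : IsFiniteActionCurve ℓ γ b t)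
    (hbt : b ≤ t) {K : ℝ≥0} {s : Set (V × ℝ)} (hLip : LipschitzOnWith K ψ s) {δ : ℝ}
    (hγs : ∀ τ ∈ Icc b t, (γ τ, τ) ∈ s)
    (hψ : ∀ q ∈ s, DifferentiableAt ℝ ψ q ∧ ∀ v, fderiv ℝ ψ q (v, 1) ≤ ℓ q.1 v q.2 - δ) :
    ψ (γ t, t) - ψ (γ b, b) ≤ action ℓ γ b t - δ * (t - b) := by
  have hac : AbsolutelyContinuousOnInterval (fun τ => ψ (γ τ, τ)) b t := by
    refine absolutelyContinuousOnInterval_of_dist_le (K := K) hγ.absolutelyContinuous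
      fun τ hτ σ hσ => ?_
    rw [uIcc_of_le hbt] at hτ hσ
    refine (hLip.dist_le_mul _ (hγs τ hτ) _ (hγs σ hσ)).trans ?_
    gcongr
    exact max_le_add_of_nonneg dist_nonneg dist_nonneg
  have h_int : ∫ τ in b..t, (ℓ (γ τ) (deriv γ τ) τ - δ) = action ℓ γ b t - δ * (t - b) := by
    rw [intervalIntegral.integral_sub hγ.intervalIntegrable intervalIntegrable_const,
      intervalIntegral.integral_const, smul_eq_mul, mul_comm, action]
  rw [← h_int]
  refine sub_le_integral_of_deriv_le hbt hac
    (hγ.intervalIntegrable.sub intervalIntegrable_const) ?_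
  filter_upwards [ae_hasDerivAt_of_absolutelyContinuousOnInterval hγ.absolutelyContinuous]
    with τ hτ hτbt
  obtain ⟨hdiff, hle⟩ := hψ _ (hγs τ ⟨hτbt.1.le, hτbt.2.le⟩)
  have hderiv : HasDerivAt (fun τ => ψ (γ τ, τ)) (fderiv ℝ ψ (γ τ, τ) (deriv γ τ, 1)) τ :=
    hdiff.hasFDerivAt.comp_hasDerivAt (f := fun τ => (γ τ, τ)) τ
      ((hτ hτbt).prodMk (hasDerivAt_id τ))
  exact hderiv.deriv ▸ hle (deriv γ τ)

lemma IsTonelliCost.frequently_lt_fderiv_of_isLocalMin [FiniteDimensional ℝ V]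
    (hℓ : IsTonelliCost ℓ) (hG : ∀ x, |g x| ≤ G) (hat : a < t) (hψ : ContDiffAt ℝ 1 ψ (x, t))
    (hmin : IsLocalMin (fun q : V × ℝ => value ℓ g a q.1 q.2 - ψ q) (x, t)) {δ : ℝ}
    (hδ : 0 < δ) :
    ∃ᶠ q in 𝓝 (x, t), ∃ v, ℓ q.1 v q.2 - δ < fderiv ℝ ψ q (v, 1) := by
  by_contra hstrict
  simp only [not_frequently, not_exists, not_lt] at hstrict
  obtain ⟨K, S, hS, hLip⟩ := hψ.exists_lipschitzOnWith
  have hdiff : ∀ᶠ q in 𝓝 (x, t), DifferentiableAt ℝ ψ q :=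
    (hψ.eventually (by norm_num)).mono fun q hq => hq.differentiableAt one_ne_zero
  obtain ⟨b, hb, hnear⟩ := hℓ.exists_near_optimal_of_mem_nhds hG hat
    (inter_mem hS ((hdiff.and hstrict).and hmin))
  have hδb : 0 < δ * (t - b) := mul_pos hδ (sub_pos.2 hb.2)
  obtain ⟨γ, hγ, rfl, hopt, hγs⟩ := hnear (δ * (t - b) / 2) (half_pos hδb)
  have hψγ := sub_le_action_sub_of_fderiv_le hγ hb.2.le (hLip.mono inter_subset_left) hγs
    fun q hq => hq.2.1
  have hminγ : value ℓ g a (γ t) t - ψ (γ t, t) ≤ value ℓ g a (γ b) b - ψ (γ b, b) :=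
    (hγs b ⟨le_rfl, hb.2.le⟩).2.2
  linarith

end Touching

section PartialDerivatives

variable {F : Type*} [NormedAddCommGroup F] [InnerProductSpace ℝ F]
  {ψ : F × ℝ → ℝ} {x : F} {t : ℝ}

lemma deriv_snd_eq (hψ : DifferentiableAt ℝ ψ (x, t)) :
    deriv (fun s => ψ (x, s)) t = fderiv ℝ ψ (x, t) (0, 1) :=
  (hψ.hasFDerivAt.comp_hasDerivAt t ((hasDerivAt_const t x).prodMk (hasDerivAt_id t))).deriv

lemma continuousAt_deriv_snd (hψ : ContDiffAt ℝ 1 ψ (x, t)) :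
    ContinuousAt (fun q : F × ℝ => deriv (fun s => ψ (q.1, s)) q.2) (x, t) := by
  have hcont : ContinuousAt (fun q => fderiv ℝ ψ q (0, 1)) (x, t) := by
    have hfderiv := (hψ.fderiv_right (m := 0) (by norm_num)).continuousAt
    fun_prop
  refine hcont.congr ?_
  filter_upwards [hψ.eventually (by norm_num)] with q hq
  exact (deriv_snd_eq (hq.differentiableAt one_ne_zero)).symm

variable [CompleteSpace F]

lemma gradient_fst_eq (hψ : DifferentiableAt ℝ ψ (x, t)) :
    gradient (fun y => ψ (y, t)) x = (InnerProductSpace.toDual ℝ F).symm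
      ((fderiv ℝ ψ (x, t)).comp (.inl ℝ F ℝ)) :=
  congrArg (InnerProductSpace.toDual ℝ F).symm
    (hψ.hasFDerivAt.comp x (hasFDerivAt_prodMk_left x t)).fderiv

lemma fderiv_apply_prod_one (hψ : DifferentiableAt ℝ ψ (x, t)) (v : F) :
    fderiv ℝ ψ (x, t) (v, 1) =
      deriv (fun s => ψ (x, s)) t + inner ℝ (gradient (fun y => ψ (y, t)) x) v := by
  rw [gradient_fst_eq hψ, deriv_snd_eq hψ, InnerProductSpace.toDual_symm_apply,
    ContinuousLinearMap.comp_apply, ContinuousLinearMap.inl_apply, ← map_add]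
  simp

lemma continuousAt_gradient_fst (hψ : ContDiffAt ℝ 1 ψ (x, t)) :
    ContinuousAt (fun q : F × ℝ => gradient (fun y => ψ (y, q.2)) q.1) (x, t) := by
  have hcont : ContinuousAt (fun q => (InnerProductSpace.toDual ℝ F).symm
      ((fderiv ℝ ψ q).comp (.inl ℝ F ℝ))) (x, t) := by
    have hfderiv := (hψ.fderiv_right (m := 0) (by norm_num)).continuousAt
    fun_prop
  refine hcont.congr ?_
  filter_upwards [hψ.eventually (by norm_num)] with q hq
  exact (gradient_fst_eq (hq.differentiableAt one_ne_zero)).symm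

end PartialDerivatives

section Viscosity

variable {N m : ℕ} {H : Fin m → Torus N → E N → (Fin m → ℝ) → ℝ} {φ : C(Torus N, Fin m → ℝ)}
  {u : C(Torus N × ℝ≥0, Fin m → ℝ)} {i : Fin m} {x : E N} {t : ℝ} {ψ : E N × ℝ → ℝ}

lemma laxOleinik_subsolution_test (hH : IsConvexHamiltonian (H i)) (ht : 0 < t)
    (hψ : ContDiffAt ℝ 1 ψ (x, t))
    (hmax : IsLocalMax (fun q : E N × ℝ => laxOleinik H φ u i q.1 q.2 - ψ q) (x, t)) :
    deriv (fun s => ψ (x, s)) t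
      + H i (proj x) (gradient (fun y => ψ (y, t)) x) (u (proj x, t.toNNReal)) ≤ 0 :=
  have hdiff := hψ.differentiableAt one_ne_zero
  hH.add_le_zero_of_forall_le_lagrangian fun v => fderiv_apply_prod_one hdiff v ▸
    (hH.isTonelliCost u).fderiv_le_of_isLocalMax (abs_datum_le φ i) ht hdiff hmax v

lemma laxOleinik_supersolution_test (hH : IsConvexHamiltonian (H i)) (ht : 0 < t)
    (hψ : ContDiffAt ℝ 1 ψ (x, t))
    (hmin : IsLocalMin (fun q : E N × ℝ => laxOleinik H φ u i q.1 q.2 - ψ q) (x, t)) :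
    0 ≤ deriv (fun s => ψ (x, s)) t
      + H i (proj x) (gradient (fun y => ψ (y, t)) x) (u (proj x, t.toNNReal)) := by
  let b : E N × ℝ → ℝ := fun q => deriv (fun s => ψ (q.1, s)) q.2
    + H i (proj q.1) (gradient (fun y => ψ (y, q.2)) q.1) (u (proj q.1, q.2.toNNReal))
  have hb : ContinuousAt b (x, t) := (continuousAt_deriv_snd hψ).add <|
    hH.continuous.continuousAt.comp
      (f := fun q : E N × ℝ =>
        (proj q.1, gradient (fun y => ψ (y, q.2)) q.1, u (proj q.1, q.2.toNNReal)))
      (((continuous_proj N).comp continuous_fst).continuousAt.prodMk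
        ((continuousAt_gradient_fst hψ).prodMk (continuous_lift u).continuousAt))
  by_contra! hneg
  have hδ : 0 < -b (x, t) / 2 := by simp only [b]; linarith
  refine (hH.isTonelliCost u).frequently_lt_fderiv_of_isLocalMin (abs_datum_le φ i) ht hψ hmin
    hδ ?_
  filter_upwards [hb.eventually_lt_const (by linarith : b (x, t) < b (x, t) / 2),
    hψ.eventually (by norm_num)] with q hbq hψq
  rintro ⟨v, hv⟩
  have hFenchel := hH.inner_sub_le_lagrangian (proj q.1) v (gradient (fun y => ψ (y, q.2)) q.1)
    (u (proj q.1, q.2.toNNReal))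
  rw [fderiv_apply_prod_one (hψq.differentiableAt one_ne_zero)] at hv
  simp only [b, cost] at hbq hv
  linarith

lemma IsVariationalSolution.eventuallyEq_laxOleinik (hH : ∀ i, IsConvexHamiltonian (H i))
    (hu : IsVariationalSolution H φ u) (i : Fin m) (x : E N) (ht : 0 < t) (ψ : E N × ℝ → ℝ) :
    (fun q : E N × ℝ => u (proj q.1, q.2.toNNReal) i - ψ q) =ᶠ[𝓝 (x, t)]
      fun q => laxOleinik H φ u i q.1 q.2 - ψ q := by
  filter_upwards [continuous_snd.continuousAt.eventually (Ioi_mem_nhds ht)] with q hq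
  rw [hu.eq_laxOleinik hH i q.1 (le_of_lt hq)]

lemma IsVariationalSolution.apply_zero (hu : IsVariationalSolution H φ u)
    (hH : ∀ i, IsConvexHamiltonian (H i)) (x : Torus N) (i : Fin m) : u (x, 0) i = φ x i := by
  obtain ⟨x, rfl⟩ := proj_surjective N x
  rw [← Real.toNNReal_zero, hu.eq_laxOleinik hH i x le_rfl]
  exact ((hH i).isTonelliCost u).value_self (abs_datum_le φ i) 0 x

theorem IsVariationalSolution.isViscositySolution (hH : ∀ i, IsConvexHamiltonian (H i))
    (hu : IsVariationalSolution H φ u) : IsViscositySolution H φ u :=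
  ⟨fun i => ⟨fun x => (hu.apply_zero hH x i).le, fun x _ ht ψ hψ hmax =>
      laxOleinik_subsolution_test (hH i) ht hψ
        ((hu.eventuallyEq_laxOleinik hH i x ht ψ).isLocalMax_iff.1 hmax)⟩,
    fun i => ⟨fun x => (hu.apply_zero hH x i).ge, fun x _ ht ψ hψ hmin =>
      laxOleinik_supersolution_test (hH i) ht hψ
        ((hu.eventuallyEq_laxOleinik hH i x ht ψ).isLocalMin_iff.1 hmin)⟩⟩

end Viscosity

/-! ### Lipschitz regularity -/

/-- Iterating the hypothesis from any bound `(2 * κ + c) * w` halves the excess `c` each time. -/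
lemma le_two_mul_mul_of_le_add_half {α : Type*} {s : Set α} {f w : α → ℝ} {κ B : ℝ} (hκ : 0 ≤ κ)
    (hw : ∀ a ∈ s, 1 ≤ w a) (hB : ∀ a ∈ s, f a ≤ B)
    (hstep : ∀ d, 0 ≤ d → (∀ a ∈ s, f a ≤ d * w a) → ∀ a ∈ s, f a ≤ κ + d / 2 * w a)
    {a : α} (ha : a ∈ s) : f a ≤ 2 * κ * w a := by
  have hiter (n : ℕ) : ∀ a ∈ s, f a ≤ (2 * κ + |B| * (1 / 2) ^ n) * w a := by
    induction n with
    | zero =>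
      intro a ha
      have hBw : |B| ≤ |B| * w a := le_mul_of_one_le_right (abs_nonneg B) (hw a ha)
      have hκw : 0 ≤ 2 * κ * w a := mul_nonneg (by positivity) (zero_le_one.trans (hw a ha))
      linarith [hB a ha, le_abs_self B]
    | succ n ih =>
      intro a ha
      have hκw : κ ≤ κ * w a := le_mul_of_one_le_right hκ (hw a ha)
      calc f a ≤ κ + (2 * κ + |B| * (1 / 2) ^ n) / 2 * w a := hstep _ (by positivity) ih a ha
        _ ≤ κ * w a + (2 * κ + |B| * (1 / 2) ^ n) / 2 * w a := by gcongr
        _ = (2 * κ + |B| * (1 / 2) ^ (n + 1)) * w a := by ring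
  have hlim : Tendsto (fun n : ℕ => (2 * κ + |B| * (1 / 2) ^ n) * w a) atTop
      (𝓝 ((2 * κ + |B| * 0) * w a)) :=
    (((tendsto_pow_atTop_nhds_zero_of_lt_one (by norm_num) (by norm_num)).const_mul _).const_add
      _).mul_const _
  simpa using ge_of_tendsto' hlim fun n => hiter n a ha

section Lipschitz

variable {N m : ℕ} {H : Fin m → Torus N → E N → (Fin m → ℝ) → ℝ} {φ : C(Torus N, Fin m → ℝ)}
  {u : C(Torus N × ℝ≥0, Fin m → ℝ)} {i : Fin m} {K Θ : ℝ≥0} {S T : ℝ}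

lemma datum_sub_le (hφ : LipschitzWith K φ) (i : Fin m) (x y : E N) :
    φ (proj x) i - φ (proj y) i ≤ K * dist x y :=
  calc φ (proj x) i - φ (proj y) i ≤ dist (φ (proj x) i) (φ (proj y) i) := le_abs_self _
    _ ≤ dist (φ (proj x)) (φ (proj y)) := dist_le_pi_dist _ _ i
    _ ≤ K * dist (proj x) (proj y) := hφ.dist_le_mul _ _
    _ ≤ K * dist x y := by
      gcongr
      simpa using (lipschitzWith_proj N).dist_le_mul x y

lemma exists_cost_bounds (hH : ∀ i, IsConvexHamiltonian (H i))
    (u : C(Torus N × ℝ≥0, Fin m → ℝ)) (K T : ℝ) :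
    ∃ S, 0 ≤ S ∧ ∀ i x v, ∀ s ≤ T,
      K * ‖v‖ - S ≤ cost (H i) u x v s ∧ (‖v‖ ≤ 1 → cost (H i) u x v s ≤ S) := by
  choose C hC₀ hC using fun i => ((hH i).isTonelliCost u).superlinear K T
  choose D hD₀ hD using fun i => ((hH i).isTonelliCost u).bounded 1 T
  have hsum (i : Fin m) : C i + D i ≤ ∑ i, (C i + D i) :=
    Finset.single_le_sum (f := fun i => C i + D i) (fun i _ => add_nonneg (hC₀ i) (hD₀ i))
      (Finset.mem_univ i)
  refine ⟨∑ i, (C i + D i), Finset.sum_nonneg fun i _ => add_nonneg (hC₀ i) (hD₀ i),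
    fun i x v s hs => ⟨?_, fun hv => ?_⟩⟩
  · linarith [hC i x v s hs, hsum i, hD₀ i]
  · linarith [hD i x v hv s hs, hsum i, hC₀ i]

namespace IsVariationalSolution

lemma apply_le_apply_add_mul (hu : IsVariationalSolution H φ u)
    (hH : ∀ i, IsConvexHamiltonian (H i))
    (hS : ∀ x v, ‖v‖ ≤ 1 → ∀ s ≤ T, cost (H i) u x v s ≤ S) {x y : E N} {t r : ℝ} (ht : 0 ≤ t)
    (hr : 0 ≤ r) (htr : t + r ≤ T) (hxy : ‖y - x‖ ≤ r) :
    u (proj y, (t + r).toNNReal) i ≤ u (proj x, t.toNNReal) i + S * r := by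
  rw [hu.eq_laxOleinik hH i y (by positivity), hu.eq_laxOleinik hH i x ht]
  have hmove := ((hH i).isTonelliCost u).value_le_value_add_mul (abs_datum_le φ i) hS ht
    (le_add_of_nonneg_right hr) htr (by simpa using hxy)
  rwa [add_sub_cancel_left] at hmove

lemma norm_sub_time_le_add (hu : IsVariationalSolution H φ u)
    (hH : ∀ i, IsConvexHamiltonian (H i)) (hΘ : ∀ i x p, LipschitzWith Θ (H i x p))
    (hφ : LipschitzWith K φ) (hS₀ : 0 ≤ S)
    (hS : ∀ i x v, ∀ s ≤ T,
      K * ‖v‖ - S ≤ cost (H i) u x v s ∧ (‖v‖ ≤ 1 → cost (H i) u x v s ≤ S))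
    {d r t : ℝ} (hd : 0 ≤ d) (hr : 0 ≤ r) (ht : t ∈ Icc 0 (T - r))
    (hdu : ∀ y, ∀ s ∈ Icc 0 (T - r),
      ‖u (y, s.toNNReal) - u (y, (s + r).toNNReal)‖ ≤ d * Real.exp (2 * Θ * s)) (x : Torus N) :
    ‖u (x, t.toNNReal) - u (x, (t + r).toNNReal)‖ ≤ S * r + d / 2 * Real.exp (2 * Θ * t) := by
  obtain ⟨x, rfl⟩ := proj_surjective N x
  have htr : t + r ≤ T := by linarith [ht.2]
  refine (pi_norm_le_iff_of_nonneg (by positivity)).2 fun i => ?_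
  have hstay := hu.apply_le_apply_add_mul hH (fun x v hv s hs => (hS i x v s hs).2 hv) ht.1 hr htr
    (x := x) (y := x) (by simpa using hr)
  have hshift := ((hH i).isTonelliCost u).value_le_value_add_time (abs_datum_le φ i) (κ := 0)
    (K := K) (C := S) (e := fun s => Θ * (d * Real.exp (2 * Θ * s))) x ht.1 hr K.2
    (by simpa using datum_sub_le hφ i) (fun y v s hs => (hS i y v s (by linarith [ht.1])).1)
    (by fun_prop) fun y v s hs => ((hH i).abs_cost_sub_le (hΘ i) u u y v s (s + r)).trans
      (by gcongr; exact hdu _ s ⟨hs.1, hs.2.trans ht.2⟩)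
  change laxOleinik H φ u i x t ≤ laxOleinik H φ u i x (t + r) + _ at hshift
  rw [← hu.eq_laxOleinik hH i x ht.1, ← hu.eq_laxOleinik hH i x (add_nonneg ht.1 hr)] at hshift
  have h_int := mul_integral_exp_le Θ hd t
  have hexp : 0 ≤ d / 2 * Real.exp (2 * Θ * t) := by positivity
  rw [Pi.sub_apply, Real.norm_eq_abs]
  exact abs_le.2 ⟨by linarith, by linarith⟩

lemma exists_norm_sub_time_le (hu : IsVariationalSolution H φ u)
    (hH : ∀ i, IsConvexHamiltonian (H i)) (hφ : LipschitzWith K φ) (T : ℝ) :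
    ∃ M, 0 ≤ M ∧ ∀ x t r, 0 ≤ t → 0 ≤ r → t + r ≤ T →
      ‖u (x, t.toNNReal) - u (x, (t + r).toNNReal)‖ ≤ M * r := by
  obtain ⟨Θ, -, hΘ⟩ := exists_lipschitzWith hH
  obtain ⟨S, hS₀, hS⟩ := exists_cost_bounds hH u K T
  obtain ⟨B, -, hB⟩ := exists_norm_le u T
  refine ⟨2 * S * Real.exp (2 * Θ * T), by positivity, fun x t r ht hr htr => ?_⟩
  have hgronwall : ‖u (x, t.toNNReal) - u (x, (t + r).toNNReal)‖ ≤
      2 * (S * r) * Real.exp (2 * Θ * t) :=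
    le_two_mul_mul_of_le_add_half (s := {q : Torus N × ℝ | q.2 ∈ Icc 0 (T - r)}) (B := B + B)
      (f := fun q => ‖u (q.1, q.2.toNNReal) - u (q.1, (q.2 + r).toNNReal)‖)
      (w := fun q => Real.exp (2 * Θ * q.2)) (a := (x, t)) (by positivity)
      (fun q hq => Real.one_le_exp (mul_nonneg (by positivity) hq.1))
      (fun q hq => (norm_sub_le _ _).trans (add_le_add
        (hB _ _ (hq.2.trans (sub_le_self T hr))) (hB _ _ (le_sub_iff_add_le.1 hq.2))))
      (fun d hd hdu q hq => hu.norm_sub_time_le_add hH hΘ hφ hS₀ hS hd hr hq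
        (fun y s hs => hdu (y, s) hs) q.1)
      ⟨ht, le_sub_iff_add_le.2 htr⟩
  calc ‖u (x, t.toNNReal) - u (x, (t + r).toNNReal)‖
      ≤ 2 * (S * r) * Real.exp (2 * Θ * t) := hgronwall
    _ ≤ 2 * (S * r) * Real.exp (2 * Θ * T) := by
        gcongr
        linarith
    _ = 2 * S * Real.exp (2 * Θ * T) * r := by ring

/-- The point `(y, t)` is compared with `(x, t - ‖y - x‖)` by moving at unit speed, or with the
initial time if `t` is too small for that. -/
lemma exists_apply_sub_space_le (hu : IsVariationalSolution H φ u)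
    (hH : ∀ i, IsConvexHamiltonian (H i)) (hφ : LipschitzWith K φ) (T : ℝ) :
    ∃ M, ∀ i (x y : E N), ∀ t ∈ Icc 0 T,
      u (proj x, t.toNNReal) i - u (proj y, t.toNNReal) i ≤ M * ‖x - y‖ := by
  obtain ⟨M, hM₀, hM⟩ := hu.exists_norm_sub_time_le hH hφ T
  obtain ⟨S, hS₀, hS⟩ := exists_cost_bounds hH u K T
  have htime (i : Fin m) (z : Torus N) {t r : ℝ} (ht : 0 ≤ t) (hr : 0 ≤ r) (htr : t + r ≤ T) :
      |u (z, t.toNNReal) i - u (z, (t + r).toNNReal) i| ≤ M * r :=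
    (norm_le_pi_norm (u (z, t.toNNReal) - u (z, (t + r).toNNReal)) i).trans (hM z t r ht hr htr)
  refine ⟨2 * M + K + S, fun i x y t ht => ?_⟩
  have hMn : 0 ≤ M * ‖x - y‖ := by positivity
  have hKn : 0 ≤ K * ‖x - y‖ := by positivity
  have hSn : 0 ≤ S * ‖x - y‖ := by positivity
  rcases le_total ‖x - y‖ t with hle | hle
  · obtain ⟨s, hs, rfl⟩ : ∃ s, 0 ≤ s ∧ s + ‖x - y‖ = t :=
      ⟨t - ‖x - y‖, sub_nonneg.2 hle, sub_add_cancel _ _⟩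
    have hmove := hu.apply_le_apply_add_mul hH (fun x v hv s hs => (hS i x v s hs).2 hv) hs
      (norm_nonneg _) ht.2 le_rfl
    linarith [(abs_le.1 (htime i (proj y) hs (norm_nonneg _) ht.2)).2]
  · have hinit (z : E N) : |φ (proj z) i - u (proj z, t.toNNReal) i| ≤ M * t := by
      simpa [hu.apply_zero hH] using htime i (proj z) le_rfl ht.1 (by simpa using ht.2)
    have hdatum := dist_eq_norm x y ▸ datum_sub_le hφ i x y
    have hMt : M * t ≤ M * ‖x - y‖ := by gcongr
    linarith [(abs_le.1 (hinit x)).1, (abs_le.1 (hinit y)).2]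

end IsVariationalSolution

end Lipschitz

/-! ### Comparison by doubling of variables -/

section Comparison

variable {N : ℕ} {F G : E N × ℝ × E N → ℝ} {w U f : E N × ℝ → ℝ} {T K c : ℝ}

/-- Viscosity subsolutions `w` of `∂ₜ w + F(x, t, ∂ₓ w) = 0` on `ℝ^N × (0, T)`. -/
def IsSubsolutionOn (F : E N × ℝ × E N → ℝ) (T : ℝ) (w : E N × ℝ → ℝ) : Prop :=
  ∀ (x : E N) (t : ℝ), t ∈ Ioo 0 T → ∀ ψ : E N × ℝ → ℝ, ContDiffAt ℝ 1 ψ (x, t) →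
    IsLocalMax (fun q => w q - ψ q) (x, t) →
    deriv (fun s => ψ (x, s)) t + F (x, t, gradient (fun y => ψ (y, t)) x) ≤ 0

/-- Viscosity supersolutions `w` of `∂ₜ w + F(x, t, ∂ₓ w) = 0` on `ℝ^N × (0, T)`. -/
def IsSupersolutionOn (F : E N × ℝ × E N → ℝ) (T : ℝ) (w : E N × ℝ → ℝ) : Prop :=
  ∀ (x : E N) (t : ℝ), t ∈ Ioo 0 T → ∀ ψ : E N × ℝ → ℝ, ContDiffAt ℝ 1 ψ (x, t) →
    IsLocalMin (fun q => w q - ψ q) (x, t) →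
    0 ≤ deriv (fun s => ψ (x, s)) t + F (x, t, gradient (fun y => ψ (y, t)) x)

/-- Lifts to `ℝ^N × ℝ` of functions on `𝕋^N × ℝ`. -/
def IsPeriodic (f : E N × ℝ → ℝ) : Prop :=
  ∀ x y t, proj x = proj y → f (x, t) = f (y, t)

/-- Lipschitz continuity in `x` with constant `K`, uniformly for `t ∈ [0, T]`. -/
def IsSpaceLipschitzOn (K T : ℝ) (f : E N × ℝ → ℝ) : Prop :=
  ∀ x y, ∀ t ∈ Icc 0 T, f (x, t) - f (y, t) ≤ K * ‖x - y‖

/-- A function of time is added to a test function by adding its derivative to the Hamiltonian. -/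
lemma IsSubsolutionOn.sub_time (hw : IsSubsolutionOn F T w) {b : ℝ → ℝ} (hb : ContDiff ℝ 1 b) :
    IsSubsolutionOn (fun z => F z + deriv b z.2.1) T fun q => w q - b q.2 := by
  intro x t ht ψ hψ hmax
  have htest := hw x t ht (fun q => ψ q + b q.2) (hψ.add (hb.comp contDiff_snd).contDiffAt)
    (by simpa only [sub_sub, add_comm] using hmax)
  have hψt : DifferentiableAt ℝ (fun s => ψ (x, s)) t :=
    (hψ.differentiableAt one_ne_zero).comp t (by fun_prop : DifferentiableAt ℝ (fun s => (x, s)) t)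
  have hgrad : gradient (fun y => ψ (y, t) + b t) x = gradient (fun y => ψ (y, t)) x := by
    simp only [gradient, fderiv_add_const]
  rw [deriv_fun_add hψt (hb.differentiable one_ne_zero t), hgrad] at htest
  linarith

lemma IsPeriodic.sub_time (hf : IsPeriodic f) (b : ℝ → ℝ) :
    IsPeriodic fun q => f q - b q.2 := fun x y t hxy => by simp only [hf x y t hxy]

lemma IsSpaceLipschitzOn.sub_time (hf : IsSpaceLipschitzOn K T f) (b : ℝ → ℝ) :
    IsSpaceLipschitzOn K T fun q => f q - b q.2 := fun x y t ht => by
  simpa using hf x y t ht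

lemma IsPeriodic.exists_abs_le (hfp : IsPeriodic f) (hf : Continuous f) (T : ℝ) :
    ∃ B, ∀ z : E N × ℝ, z.2 ∈ Icc 0 T → |f z| ≤ B := by
  obtain ⟨R, hR⟩ := exists_proj_eq_norm_le N
  obtain ⟨B, hB⟩ := ((isCompact_closedBall (0 : E N) R).prod
    (isCompact_Icc (a := (0 : ℝ)) (b := T))).exists_bound_of_continuousOn hf.continuousOn
  refine ⟨B, fun z hz => ?_⟩
  obtain ⟨y, hy, hyR⟩ := hR (proj z.1)
  exact hfp y z.1 z.2 hy ▸ hB (y, z.2) ⟨by simpa using hyR, hz⟩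

/-- The test function `c/2 (|x - y|² + (t - s)²)` of the doubling argument. -/
def quadraticTest (c : ℝ) (y : E N) (s : ℝ) (q : E N × ℝ) : ℝ :=
  c / 2 * (‖q.1 - y‖ ^ 2 + (q.2 - s) ^ 2)

lemma contDiff_quadraticTest (c : ℝ) (y : E N) (s : ℝ) : ContDiff ℝ 1 (quadraticTest c y s) :=
  contDiff_const.mul (((contDiff_fst.sub contDiff_const).norm_sq ℝ).add
    ((contDiff_snd.sub contDiff_const).pow 2))

lemma gradient_quadraticTest (c : ℝ) (y : E N) (s : ℝ) (x : E N) (t : ℝ) :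
    gradient (fun z => quadraticTest c y s (z, t)) x = c • (x - y) := by
  refine HasGradientAt.gradient ?_
  rw [hasGradientAt_iff_hasFDerivAt]
  have hsq : HasFDerivAt (fun z : E N => ‖z - y‖ ^ 2) (2 • innerSL ℝ (x - y)) x := by
    simpa using ((hasFDerivAt_id x).sub_const y).norm_sq
  refine ((hsq.add_const ((t - s) ^ 2)).const_mul (c / 2)).congr_fderiv ?_
  ext v
  simp
  ring

lemma deriv_quadraticTest (c : ℝ) (y : E N) (s : ℝ) (x : E N) (t : ℝ) :
    deriv (fun r => quadraticTest c y s (x, r)) t = c * (t - s) := by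
  have hsq : HasDerivAt (fun r : ℝ => (r - s) ^ 2) (2 * (t - s)) t := by
    simpa using ((hasDerivAt_id t).sub_const s).fun_pow 2
  refine (((hsq.const_add (‖x - y‖ ^ 2)).const_mul (c / 2)).congr_deriv ?_).deriv
  ring

/-- The function maximised in the doubling argument. -/
def penalized (w U : E N × ℝ → ℝ) (c : ℝ) (p q : E N × ℝ) : ℝ :=
  w p - U q - quadraticTest c q.1 q.2 p

/-- The pair `(p, q)` maximises `penalized w U c` among the pairs with times in `[0, T]` and space
components at distance at most `1`; the latter restriction provides compactness on the torus. -/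
structure IsDoubledMax (w U : E N × ℝ → ℝ) (c T : ℝ) (p q : E N × ℝ) : Prop where
  norm_sub_le : ‖p.1 - q.1‖ ≤ 1
  left_mem : p.2 ∈ Icc 0 T
  right_mem : q.2 ∈ Icc 0 T
  le : ∀ p' q' : E N × ℝ, ‖p'.1 - q'.1‖ ≤ 1 → p'.2 ∈ Icc 0 T → q'.2 ∈ Icc 0 T →
    penalized w U c p' q' ≤ penalized w U c p q

lemma exists_isDoubledMax (hw : Continuous w) (hU : Continuous U) (hwp : IsPeriodic w)
    (hUp : IsPeriodic U) (hT : 0 ≤ T) :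
    ∃ R, ∀ c, ∃ p q, ‖p.1‖ ≤ R ∧ IsDoubledMax w U c T p q := by
  obtain ⟨R, hR⟩ := exists_proj_eq_norm_le N
  refine ⟨R, fun c => ?_⟩
  let Φ : (E N × E N) × ℝ × ℝ → ℝ :=
    fun z => penalized w U c (z.1.1, z.2.1) (z.1.1 - z.1.2, z.2.2)
  have hΦ : Continuous Φ := by
    simp only [Φ, penalized, quadraticTest]
    fun_prop
  let S : Set ((E N × E N) × ℝ × ℝ) :=
    (Metric.closedBall 0 R ×ˢ Metric.closedBall 0 1) ×ˢ Icc 0 T ×ˢ Icc 0 T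
  have hS : IsCompact S := ((isCompact_closedBall _ _).prod (isCompact_closedBall _ _)).prod
    (isCompact_Icc.prod isCompact_Icc)
  obtain ⟨y₀, -, hy₀⟩ := hR 0
  obtain ⟨⟨⟨x, e⟩, t, s⟩, ⟨⟨hx, he⟩, ht, hs⟩, hmax⟩ := hS.exists_isMaxOn
    ⟨((y₀, 0), 0, 0), ⟨by simpa using hy₀, by simp⟩, by simpa using hT, by simpa using hT⟩
    hΦ.continuousOn
  refine ⟨(x, t), (x - e, s), by simpa using hx, by simpa using he, ht, hs,
    fun p q hpq hp hq => ?_⟩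
  obtain ⟨z, hz, hzR⟩ := hR (proj p.1)
  have hle : Φ ((z, p.1 - q.1), p.2, q.2) ≤ Φ ((x, e), t, s) :=
    hmax (show _ ∈ S from ⟨⟨by simpa using hzR, by simpa using hpq⟩, hp, hq⟩)
  have hproj : proj (z - (p.1 - q.1)) = proj q.1 := by
    rw [proj_sub, hz, ← proj_sub, sub_sub_cancel]
  simpa only [Φ, penalized, quadraticTest, sub_sub_cancel, hwp z p.1 p.2 hz, hUp _ q.1 q.2 hproj]
    using hle

namespace IsDoubledMax

variable {p q : E N × ℝ}

lemma sub_le_penalized (h : IsDoubledMax w U c T p q) {z : E N × ℝ} (hz : z.2 ∈ Icc 0 T) :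
    w z - U z ≤ penalized w U c p q := by
  simpa [penalized, quadraticTest] using h.le z z (by simp) hz hz

/-- The maximum dominates the values at the diagonal pairs over `p` and over `q`. -/
lemma norm_smul_sub_le (h : IsDoubledMax w U c T p q) (hc : 0 ≤ c)
    (hLip : IsSpaceLipschitzOn K T w ∨ IsSpaceLipschitzOn K T U) :
    ‖c • (p.1 - q.1)‖ ≤ 2 * |K| := by
  have hquad : c / 2 * ‖p.1 - q.1‖ ^ 2 ≤ K * ‖p.1 - q.1‖ := by
    rcases hLip with hL | hL
    · have hmove := h.le (q.1, p.2) q (by simp) h.left_mem h.right_mem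
      have hw := hL p.1 q.1 p.2 h.left_mem
      simp only [penalized, quadraticTest, sub_self, norm_zero] at hmove
      linarith
    · have hmove := h.le p (p.1, q.2) (by simp) h.left_mem h.right_mem
      have hU := hL p.1 q.1 q.2 h.right_mem
      simp only [penalized, quadraticTest, sub_self, norm_zero] at hmove
      linarith
  rw [norm_smul, Real.norm_of_nonneg hc]
  rcases (norm_nonneg (p.1 - q.1)).eq_or_lt with hzero | hpos
  · rw [← hzero, mul_zero]
    positivity
  · have hK : c / 2 * ‖p.1 - q.1‖ ≤ K := le_of_mul_le_mul_right (by linarith) hpos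
    linarith [le_abs_self K]

lemma mul_norm_sub_sq_le (h : IsDoubledMax w U c T p q) (hc : 0 ≤ c) {A B : ℝ}
    (hA : ∀ z : E N × ℝ, z.2 ∈ Icc 0 T → |w z| ≤ A) (hB : ∀ z : E N × ℝ, z.2 ∈ Icc 0 T → |U z| ≤ B)
    {z : E N × ℝ} (hz : z.2 ∈ Icc 0 T) (hpos : 0 < w z - U z) :
    c * ‖p - q‖ ^ 2 ≤ 2 * (A + B) := by
  have hnorm : ‖p - q‖ ^ 2 ≤ ‖p.1 - q.1‖ ^ 2 + (p.2 - q.2) ^ 2 := by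
    rw [Prod.norm_def]
    rcases max_choice ‖(p - q).1‖ ‖(p - q).2‖ with hmax | hmax <;> rw [hmax]
    · exact le_add_of_nonneg_right (sq_nonneg _)
    · rw [Real.norm_eq_abs, sq_abs]
      exact le_add_of_nonneg_left (sq_nonneg _)
  have hle := h.sub_le_penalized hz
  have hcnorm : c * ‖p - q‖ ^ 2 ≤ c * (‖p.1 - q.1‖ ^ 2 + (p.2 - q.2) ^ 2) := by gcongr
  simp only [penalized, quadraticTest] at hle
  linarith [(abs_le.1 (hA p h.left_mem)).2, (abs_le.1 (hB q h.right_mem)).1]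

lemma hamiltonian_le (h : IsDoubledMax w U c T p q) (hw : IsSubsolutionOn F T w)
    (hU : IsSupersolutionOn G T U) (hpq : ‖p.1 - q.1‖ < 1) (hp : p.2 ∈ Ioo 0 T)
    (hq : q.2 ∈ Ioo 0 T) :
    F (p.1, p.2, c • (p.1 - q.1)) ≤ G (q.1, q.2, c • (p.1 - q.1)) := by
  have hmax : IsLocalMax (fun z => w z - quadraticTest c q.1 q.2 z) p := by
    have hclose : ∀ᶠ z in 𝓝 p, ‖z.1 - q.1‖ < 1 :=
      (by fun_prop : Continuous fun z : E N × ℝ => ‖z.1 - q.1‖).continuousAt.eventually_lt_const hpq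
    filter_upwards [hclose, (isOpen_Ioo.preimage continuous_snd).mem_nhds hp] with z hz hzT
    have hle := h.le z q (le_of_lt hz) (Ioo_subset_Icc_self hzT) h.right_mem
    simp only [penalized] at hle
    linarith
  have hmin : IsLocalMin (fun z => U z - quadraticTest (-c) p.1 p.2 z) q := by
    have hclose : ∀ᶠ z in 𝓝 q, ‖p.1 - z.1‖ < 1 :=
      (by fun_prop : Continuous fun z : E N × ℝ => ‖p.1 - z.1‖).continuousAt.eventually_lt_const hpq
    filter_upwards [hclose, (isOpen_Ioo.preimage continuous_snd).mem_nhds hq] with z hz hzT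
    have hle := h.le p z (le_of_lt hz) h.left_mem (Ioo_subset_Icc_self hzT)
    have hsymm (z : E N × ℝ) : quadraticTest (-c) p.1 p.2 z = -quadraticTest c z.1 z.2 p := by
      simp only [quadraticTest, norm_sub_rev z.1, ← neg_sub p.2 z.2]
      ring
    simp only [penalized] at hle
    rw [hsymm, hsymm]
    linarith
  have hsub := hw p.1 p.2 hp _ (contDiff_quadraticTest c q.1 q.2).contDiffAt hmax
  have hsuper := hU q.1 q.2 hq _ (contDiff_quadraticTest (-c) p.1 p.2).contDiffAt hmin
  rw [deriv_quadraticTest, gradient_quadraticTest] at hsub hsuper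
  rw [neg_smul, ← smul_neg, neg_sub] at hsuper
  linarith

end IsDoubledMax

/-- If `w ≤ U` fails, the doubled maxima for a penalization tending to infinity accumulate at a
point of the diagonal where `w - U` is positive. -/
lemma exists_tendsto_isDoubledMax (hw : Continuous w) (hU : Continuous U) (hwp : IsPeriodic w)
    (hUp : IsPeriodic U) (hLip : IsSpaceLipschitzOn K T w ∨ IsSpaceLipschitzOn K T U)
    {z : E N × ℝ} (hz : z.2 ∈ Icc 0 T) (hpos : 0 < w z - U z) :
    ∃ (c : ℕ → ℝ) (p q : ℕ → E N × ℝ) (z₀ : E N × ℝ) (ξ₀ : E N),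
      (∀ n, IsDoubledMax w U (c n) T (p n) (q n)) ∧ Tendsto p atTop (𝓝 z₀) ∧
      Tendsto q atTop (𝓝 z₀) ∧ Tendsto (fun n => c n • ((p n).1 - (q n).1)) atTop (𝓝 ξ₀) ∧
      z₀.2 ∈ Icc 0 T ∧ 0 < w z₀ - U z₀ := by
  obtain ⟨R, hR⟩ := exists_isDoubledMax hw hU hwp hUp (hz.1.trans hz.2)
  choose p q hpR hmax using fun n : ℕ => hR ((n : ℝ) + 1)
  obtain ⟨A, hA⟩ := hwp.exists_abs_le hw T
  obtain ⟨B, hB⟩ := hUp.exists_abs_le hU T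
  obtain ⟨⟨z₀, ξ₀⟩, ⟨⟨-, hz₀⟩, -⟩, k, hk, hlim⟩ :=
    (((isCompact_closedBall (0 : E N) R).prod (isCompact_Icc (a := 0) (b := T))).prod
      (isCompact_closedBall (0 : E N) (2 * |K|))).tendsto_subseq
    (x := fun n : ℕ => (p n, ((n : ℝ) + 1) • ((p n).1 - (q n).1)))
    fun n => ⟨⟨by simpa using hpR n, (hmax n).left_mem⟩,
      by simpa using (hmax n).norm_smul_sub_le (by positivity) hLip⟩
  have hp : Tendsto (p ∘ k) atTop (𝓝 z₀) := (continuous_fst.tendsto _).comp hlim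
  have hdiff : Tendsto (fun n => p n - q n) atTop (𝓝 0) := by
    have hinv : Tendsto (fun n : ℕ => √(2 * (A + B) * (1 / ((n : ℝ) + 1)))) atTop (𝓝 0) := by
      simpa using (tendsto_one_div_add_atTop_nhds_zero_nat.const_mul (2 * (A + B))).sqrt
    refine squeeze_zero_norm (fun n => Real.le_sqrt_of_sq_le ?_) hinv
    rw [mul_one_div, le_div_iff₀' (by positivity)]
    exact (hmax n).mul_norm_sub_sq_le (by positivity) hA hB hz hpos
  have hq : Tendsto (q ∘ k) atTop (𝓝 z₀) := by
    simpa [Function.comp_def] using hp.sub (hdiff.comp hk.tendsto_atTop)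
  refine ⟨_, p ∘ k, q ∘ k, z₀, ξ₀, fun n => hmax (k n), hp, hq,
    (continuous_snd.tendsto _).comp hlim, hz₀,
    hpos.trans_le (ge_of_tendsto' (((hw.tendsto _).comp hp).sub ((hU.tendsto _).comp hq))
      fun n => ((hmax (k n)).sub_le_penalized hz).trans (sub_le_self _ ?_))⟩
  simp only [quadraticTest]
  positivity

lemma comparison_of_lt (hF : Continuous F) (hG : Continuous G) (hwc : Continuous w)
    (hUc : Continuous U) (hwp : IsPeriodic w) (hUp : IsPeriodic U) (hw : IsSubsolutionOn F T w)
    (hU : IsSupersolutionOn G T U) (hLip : IsSpaceLipschitzOn K T w ∨ IsSpaceLipschitzOn K T U)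
    (hFG : ∀ x, ∀ t ∈ Ioo 0 T, ∀ ξ, G (x, t, ξ) < F (x, t, ξ))
    (h₀ : ∀ x, w (x, 0) ≤ U (x, 0)) (hT : ∀ x, w (x, T) ≤ U (x, T)) {z : E N × ℝ}
    (hz : z.2 ∈ Icc 0 T) : w z ≤ U z := by
  by_contra! hlt
  obtain ⟨c, p, q, z₀, ξ₀, hmax, hp, hq, hξ, hz₀, hpos⟩ :=
    exists_tendsto_isDoubledMax hwc hUc hwp hUp hLip hz (sub_pos.2 hlt)
  have hp₁ := (continuous_fst.tendsto _).comp hp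
  have hp₂ := (continuous_snd.tendsto _).comp hp
  have hq₁ := (continuous_fst.tendsto _).comp hq
  have hq₂ := (continuous_snd.tendsto _).comp hq
  have hinterior : z₀.2 ∈ Ioo 0 T := by
    refine ⟨hz₀.1.lt_of_ne fun h => ?_, hz₀.2.lt_of_ne fun h => ?_⟩
    · exact (h₀ z₀.1).not_gt (h ▸ sub_pos.1 hpos)
    · exact (hT z₀.1).not_gt (h ▸ sub_pos.1 hpos)
  have hineq : ∀ᶠ n in atTop, F ((p n).1, (p n).2, c n • ((p n).1 - (q n).1)) ≤
      G ((q n).1, (q n).2, c n • ((p n).1 - (q n).1)) := by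
    have hclose : ∀ᶠ n in atTop, ‖(p n).1 - (q n).1‖ < 1 :=
      (hp₁.sub hq₁).norm.eventually_lt_const (by simp)
    filter_upwards [hclose, hp₂.eventually (isOpen_Ioo.mem_nhds hinterior),
      hq₂.eventually (isOpen_Ioo.mem_nhds hinterior)] with n hn hpn hqn
    exact (hmax n).hamiltonian_le hw hU hn hpn hqn
  have hlimit : F (z₀.1, z₀.2, ξ₀) ≤ G (z₀.1, z₀.2, ξ₀) :=
    le_of_tendsto_of_tendsto ((hF.tendsto _).comp (hp₁.prodMk_nhds (hp₂.prodMk_nhds hξ)))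
      ((hG.tendsto _).comp (hq₁.prodMk_nhds (hq₂.prodMk_nhds hξ))) hineq
  exact (hFG z₀.1 z₀.2 hinterior ξ₀).not_ge hlimit

lemma exists_contDiff_deriv_pos {t ε : ℝ} (ht : t < T) (hε : 0 < ε) (C : ℝ) :
    ∃ b : ℝ → ℝ, ContDiff ℝ 1 b ∧ (∀ s, 0 < b s) ∧ (∀ s, 0 < deriv b s) ∧ b t = ε ∧ C ≤ b T := by
  have htT : 0 < T - t := sub_pos.2 ht
  set Λ := (|C| + 1) / (ε * (T - t)) with hΛ
  have : 0 < Λ := by positivity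
  have hderiv (s : ℝ) : deriv (fun s => ε * Real.exp (Λ * (s - t))) s =
      ε * (Real.exp (Λ * (s - t)) * (Λ * 1)) :=
    ((((hasDerivAt_id s).sub_const t).const_mul Λ).exp.const_mul ε).deriv
  refine ⟨fun s => ε * Real.exp (Λ * (s - t)), by fun_prop, fun s => by positivity,
    fun s => hderiv s ▸ by positivity, by simp, ?_⟩
  calc C ≤ |C| + 1 := by linarith [le_abs_self C]
    _ = ε * (Λ * (T - t)) := by rw [hΛ]; field_simp
    _ ≤ ε * Real.exp (Λ * (T - t)) := by
      gcongr
      linarith [Real.add_one_le_exp (Λ * (T - t))]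

/-- The subsolution is lowered by a function of time which is small at a given time `t < T` and
large at `T`, so that no maximum is attained at `T`. -/
lemma comparison (hF : Continuous F) (hG : Continuous G) (hwc : Continuous w)
    (hUc : Continuous U) (hwp : IsPeriodic w) (hUp : IsPeriodic U) (hw : IsSubsolutionOn F T w)
    (hU : IsSupersolutionOn G T U) (hLip : IsSpaceLipschitzOn K T w ∨ IsSpaceLipschitzOn K T U)
    (hFG : ∀ x, ∀ t ∈ Ioo 0 T, ∀ ξ, G (x, t, ξ) ≤ F (x, t, ξ))
    (h₀ : ∀ x, w (x, 0) ≤ U (x, 0)) (x : E N) {t : ℝ} (ht : t ∈ Icc 0 T) :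
    w (x, t) ≤ U (x, t) := by
  have hbefore : ∀ t ∈ Ico 0 T, w (x, t) ≤ U (x, t) := by
    intro t ht
    refine le_of_forall_pos_le_add fun ε hε => ?_
    obtain ⟨A, hA⟩ := hwp.exists_abs_le hwc T
    obtain ⟨B, hB⟩ := hUp.exists_abs_le hUc T
    obtain ⟨b, hb, hb_pos, hb_deriv, hbt, hbT⟩ := exists_contDiff_deriv_pos ht.2 hε (A + B)
    have hT : T ∈ Icc 0 T := ⟨ht.1.trans ht.2.le, le_rfl⟩
    have : Continuous b := hb.continuous
    have : Continuous (deriv b) := hb.continuous_deriv le_rfl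
    have hlowered : w (x, t) - b t ≤ U (x, t) :=
      comparison_of_lt (F := fun z => F z + deriv b z.2.1) (w := fun q => w q - b q.2)
        (by fun_prop) hG (by fun_prop) hUc (hwp.sub_time b) hUp (hw.sub_time hb) hU
        (hLip.imp_left fun h => h.sub_time b)
        (fun y s hs ξ => (hFG y s hs ξ).trans_lt (lt_add_of_pos_right _ (hb_deriv s)))
        (fun y => by linarith [h₀ y, hb_pos 0])
        (fun y => by linarith [(abs_le.1 (hA (y, T) hT)).2, (abs_le.1 (hB (y, T) hT)).1])
        (z := (x, t)) ⟨ht.1, ht.2.le⟩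
    linarith
  rcases (ht.1.trans ht.2).eq_or_lt with rfl | hT
  · rw [le_antisymm ht.2 ht.1]
    exact h₀ x
  · exact le_on_closure (f := fun s => w (x, s)) (g := fun s => U (x, s)) hbefore (by fun_prop)
      (by fun_prop) (closure_Ico hT.ne ▸ ht)

end Comparison

/-! ### Uniqueness of viscosity solutions -/

section Uniqueness

variable {N m : ℕ} {H : Fin m → Torus N → E N → (Fin m → ℝ) → ℝ} {φ φ' : C(Torus N, Fin m → ℝ)}
  {u v : C(Torus N × ℝ≥0, Fin m → ℝ)} {i : Fin m} {Θ : ℝ≥0} {d κ K T : ℝ}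

/-- The lift of the `i`-th component of `u` to `ℝ^N × ℝ`. -/
def liftComponent (u : C(Torus N × ℝ≥0, Fin m → ℝ)) (i : Fin m) (q : E N × ℝ) : ℝ :=
  u (proj q.1, q.2.toNNReal) i

/-- The Hamiltonian `H(x, p, u(x, t))` with the coupling frozen, lifted to `ℝ^N`. -/
def frozenHamiltonian (H : Torus N → E N → (Fin m → ℝ) → ℝ)
    (u : C(Torus N × ℝ≥0, Fin m → ℝ)) (z : E N × ℝ × E N) : ℝ :=
  H (proj z.1) z.2.2 (u (proj z.1, z.2.1.toNNReal))

lemma continuous_liftComponent (u : C(Torus N × ℝ≥0, Fin m → ℝ)) (i : Fin m) :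
    Continuous (liftComponent u i) :=
  (continuous_apply i).comp (continuous_lift u)

lemma isPeriodic_liftComponent (u : C(Torus N × ℝ≥0, Fin m → ℝ)) (i : Fin m) :
    IsPeriodic (liftComponent u i) := fun x y t hxy => by
  simp only [liftComponent, hxy]

lemma IsConvexHamiltonian.continuous_frozenHamiltonian {H : Torus N → E N → (Fin m → ℝ) → ℝ}
    (hH : IsConvexHamiltonian H) (u : C(Torus N × ℝ≥0, Fin m → ℝ)) :
    Continuous (frozenHamiltonian H u) := by
  have hproj : Continuous fun z : E N × ℝ × E N => proj z.1 :=
    (continuous_proj N).comp continuous_fst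
  have hu : Continuous fun z : E N × ℝ × E N => u (proj z.1, z.2.1.toNNReal) :=
    (continuous_lift u).comp (f := fun z : E N × ℝ × E N => (z.1, z.2.1)) (by fun_prop)
  exact hH.continuous.comp
    (f := fun z : E N × ℝ × E N => (proj z.1, z.2.2, u (proj z.1, z.2.1.toNNReal)))
    (hproj.prodMk ((by fun_prop : Continuous fun z : E N × ℝ × E N => z.2.2).prodMk hu))

lemma IsViscositySubsolution.isSubsolutionOn (hu : IsViscositySubsolution H φ u) (i : Fin m)
    (T : ℝ) : IsSubsolutionOn (frozenHamiltonian (H i) u) T (liftComponent u i) :=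
  fun x t ht ψ hψ hmax => (hu i).2 x t ht.1 ψ hψ hmax

lemma IsViscositySupersolution.isSupersolutionOn (hu : IsViscositySupersolution H φ u)
    (i : Fin m) (T : ℝ) : IsSupersolutionOn (frozenHamiltonian (H i) u) T (liftComponent u i) :=
  fun x t ht ψ hψ hmin => (hu i).2 x t ht.1 ψ hψ hmin

lemma IsViscositySubsolution.apply_zero_sub_le (hu : IsViscositySubsolution H φ u)
    (hv : IsViscositySupersolution H φ' v) (hφ : dist φ φ' ≤ κ) (x : Torus N) (i : Fin m) :
    u (x, 0) i - v (x, 0) i ≤ κ := by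
  have hdatum : φ x i - φ' x i ≤ κ :=
    ((le_abs_self _).trans (dist_le_pi_dist (φ x) (φ' x) i)).trans
      ((ContinuousMap.dist_apply_le_dist x).trans hφ)
  linarith [(hu i).1 x, (hv i).1 x]

/-- `κ + d / 2 * e^{2 Θ t}` has derivative `Θ d e^{2 Θ t}`, which absorbs the error made in the
Hamiltonian by replacing `u` with `v`. -/
lemma liftComponent_sub_le (hH : ∀ i, IsConvexHamiltonian (H i))
    (hΘ : ∀ i x p, LipschitzWith Θ (H i x p)) (hd : 0 ≤ d) (hu : IsViscositySubsolution H φ u)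
    (hv : IsViscositySupersolution H φ' v) (hφ : dist φ φ' ≤ κ)
    (hduv : ∀ x, ∀ t ∈ Icc 0 T,
      ‖u (x, t.toNNReal) - v (x, t.toNNReal)‖ ≤ d * Real.exp (2 * Θ * t))
    (hLip : IsSpaceLipschitzOn K T (liftComponent u i) ∨
      IsSpaceLipschitzOn K T (liftComponent v i))
    (x : E N) {t : ℝ} (ht : t ∈ Icc 0 T) :
    liftComponent u i (x, t) - liftComponent v i (x, t) ≤ κ + d / 2 * Real.exp (2 * Θ * t) := by
  let b : ℝ → ℝ := fun s => κ + d / 2 * Real.exp (2 * Θ * s)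
  have hb : ContDiff ℝ 1 b := by fun_prop
  have hderiv (s : ℝ) : deriv b s = Θ * (d * Real.exp (2 * Θ * s)) :=
    ((hasDerivAt_half_mul_exp Θ d s).const_add κ).deriv
  have hcoupling (y : E N) (s : ℝ) (hs : s ∈ Ioo 0 T) (ξ : E N) :
      frozenHamiltonian (H i) v (y, s, ξ) ≤ frozenHamiltonian (H i) u (y, s, ξ) + deriv b s := by
    have hΘuv := (hΘ i (proj y) ξ).dist_le_mul (v (proj y, s.toNNReal)) (u (proj y, s.toNNReal))
    rw [Real.dist_eq, dist_eq_norm, norm_sub_rev] at hΘuv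
    have hΘd : Θ * ‖u (proj y, s.toNNReal) - v (proj y, s.toNNReal)‖ ≤ deriv b s := by
      rw [hderiv]
      gcongr
      exact hduv _ s (Ioo_subset_Icc_self hs)
    simp only [frozenHamiltonian]
    linarith [(abs_le.1 hΘuv).2]
  have hinit (y : E N) : liftComponent u i (y, 0) - b 0 ≤ liftComponent v i (y, 0) := by
    simp only [liftComponent, Real.toNNReal_zero, b, mul_zero, Real.exp_zero]
    linarith [hu.apply_zero_sub_le hv hφ (proj y) i]
  have hle : liftComponent u i (x, t) - b t ≤ liftComponent v i (x, t) := comparison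
    (F := fun z => frozenHamiltonian (H i) u z + deriv b z.2.1)
    (w := fun q => liftComponent u i q - b q.2)
    (((hH i).continuous_frozenHamiltonian u).add
      ((hb.continuous_deriv le_rfl).comp (by fun_prop)))
    ((hH i).continuous_frozenHamiltonian v)
    ((continuous_liftComponent u i).sub (hb.continuous.comp continuous_snd))
    (continuous_liftComponent v i) ((isPeriodic_liftComponent u i).sub_time b)
    (isPeriodic_liftComponent v i) ((hu.isSubsolutionOn i T).sub_time hb)
    (hv.isSupersolutionOn i T) (hLip.imp_left fun h => h.sub_time b) hcoupling hinit x ht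
  simp only [b] at hle
  linarith

lemma IsViscositySolution.norm_sub_le_two_mul_exp (hu : IsViscositySolution H φ u)
    (hv : IsViscositySolution H φ' v) (hH : ∀ i, IsConvexHamiltonian (H i))
    (hΘ : ∀ i x p, LipschitzWith Θ (H i x p)) (hφ : dist φ φ' ≤ κ)
    (hLip : ∀ i, IsSpaceLipschitzOn K T (liftComponent v i)) (x : Torus N) {t : ℝ}
    (ht : t ∈ Icc 0 T) :
    ‖u (x, t.toNNReal) - v (x, t.toNNReal)‖ ≤ 2 * κ * Real.exp (2 * Θ * t) := by
  have hκ : 0 ≤ κ := dist_nonneg.trans hφ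
  obtain ⟨A, -, hA⟩ := exists_norm_le u T
  obtain ⟨B, -, hB⟩ := exists_norm_le v T
  refine le_two_mul_mul_of_le_add_half (s := {q : Torus N × ℝ | q.2 ∈ Icc 0 T}) (B := A + B)
    (f := fun q => ‖u (q.1, q.2.toNNReal) - v (q.1, q.2.toNNReal)‖)
    (w := fun q => Real.exp (2 * Θ * q.2)) (a := (x, t)) hκ
    (fun q hq => Real.one_le_exp (mul_nonneg (by positivity) hq.1))
    (fun q hq => (norm_sub_le _ _).trans (add_le_add (hA _ _ hq.2) (hB _ _ hq.2))) ?_ ht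
  rintro d hd hduv ⟨x, s⟩ hs
  obtain ⟨x, rfl⟩ := proj_surjective N x
  refine (pi_norm_le_iff_of_nonneg (by positivity)).2 fun i => ?_
  have huv := liftComponent_sub_le hH hΘ hd hu.1 hv.2 hφ (fun x t ht => hduv (x, t) ht)
    (.inr (hLip i)) x hs
  have hvu := liftComponent_sub_le hH hΘ hd hv.1 hu.2 (dist_comm φ φ' ▸ hφ)
    (fun x t ht => (norm_sub_rev _ _).trans_le (hduv (x, t) ht)) (.inl (hLip i)) x hs
  exact abs_sub_le_iff.2 ⟨huv, hvu⟩

/-- Both solutions are close to the variational solution of a nearby Lipschitz datum, which is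
Lipschitz in space. -/
theorem IsViscositySolution.unique (hu : IsViscositySolution H φ u)
    (hv : IsViscositySolution H φ v) (hH : ∀ i, IsConvexHamiltonian (H i)) : u = v := by
  obtain ⟨Θ, -, hΘ⟩ := exists_lipschitzWith hH
  ext1 ⟨x, t⟩
  refine eq_of_forall_dist_le fun ε hε => ?_
  obtain ⟨K, φ', hφ'K, hφ'⟩ := exists_lipschitzWith_dist_le φ
    (by positivity : 0 < ε / (4 * Real.exp (2 * Θ * t)))
  obtain ⟨w, hw⟩ := exists_isVariationalSolution hH φ'
  obtain ⟨M, hM⟩ := hw.exists_apply_sub_space_le hH hφ'K t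
  have hclose {u} (hu : IsViscositySolution H φ u) : dist (u (x, t)) (w (x, t)) ≤ ε / 2 := by
    have hstab := hu.norm_sub_le_two_mul_exp (hw.isViscositySolution hH) hH hΘ
      (dist_comm φ' φ ▸ hφ') hM x (t := t) ⟨t.2, le_rfl⟩
    rw [Real.toNNReal_coe] at hstab
    calc dist (u (x, t)) (w (x, t))
        ≤ 2 * (ε / (4 * Real.exp (2 * Θ * t))) * Real.exp (2 * Θ * t) := by
          rwa [dist_eq_norm]
      _ = ε / 2 := by
          field_simp
          norm_num
  linarith [dist_triangle_right (u (x, t)) (v (x, t)) (w (x, t)), hclose hu, hclose hv]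

end Uniqueness

end WeaklyCoupledHJ

end

theorem theorem1p1_general {N m : ℕ}
    (H : Fin m → WeaklyCoupledHJ.Torus N → WeaklyCoupledHJ.E N → (Fin m → ℝ) → ℝ)
    (hH : ∀ i, WeaklyCoupledHJ.IsConvexHamiltonian (H i))
    (φ : C(WeaklyCoupledHJ.Torus N, Fin m → ℝ)) :
    (∃! u : C(WeaklyCoupledHJ.Torus N × ℝ≥0, Fin m → ℝ),
      WeaklyCoupledHJ.IsViscositySolution H φ u) ∧
    (∀ u : C(WeaklyCoupledHJ.Torus N × ℝ≥0, Fin m → ℝ),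
      WeaklyCoupledHJ.IsViscositySolution H φ u ↔
        WeaklyCoupledHJ.IsVariationalSolution H φ u) := by
  obtain ⟨v, hv⟩ := WeaklyCoupledHJ.exists_isVariationalSolution hH φ
  have hv_visc := hv.isViscositySolution hH
  refine ⟨⟨v, hv_visc, fun u hu => hu.unique hv_visc hH⟩, fun u => ⟨fun hu => ?_, fun hu =>
    hu.isViscositySolution hH⟩⟩
  rwa [hu.unique hv_visc hH]

theorem theorem1p1 {N m : ℕ} (hN : 0 < N) (hm : 0 < m)
    (H : Fin m → WeaklyCoupledHJ.Torus N → WeaklyCoupledHJ.E N → (Fin m → ℝ) → ℝ)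
    (hH : ∀ i, WeaklyCoupledHJ.IsAdmissible (H i))
    (φ : C(WeaklyCoupledHJ.Torus N, Fin m → ℝ)) :
    (∃! u : C(WeaklyCoupledHJ.Torus N × ℝ≥0, Fin m → ℝ),
      WeaklyCoupledHJ.IsViscositySolution H φ u) ∧
    (∀ u : C(WeaklyCoupledHJ.Torus N × ℝ≥0, Fin m → ℝ),
      WeaklyCoupledHJ.IsViscositySolution H φ u ↔
        WeaklyCoupledHJ.IsVariationalSolution H φ u) :=
  theorem1p1_general H (fun i => (hH i).isConvexHamiltonian) φ
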